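/- Let $n\ge 1$, let $\Sigma$ be a smooth complete fan in $\mathbb{R}^{n+1}$ with respect to the lattice $\mathbb{Z}^{n+1}$, and let $V=\mathbb{P}_\Sigma$ be the corresponding nonsingular complete complex toric variety, with homogeneous coordinates $x_\rho$ and toric divisors $D_\rho=\{x_\rho=0\}$ indexed by the primitive generators $\rho$ of the one-dimensional cones of $\Sigma$. Let $\Delta\subset\mathbb{R}^{n+1}$ be the convex hull of all the $\rho$, and let $F\in H^0(V,\mathcal{O}_V(\sum_\rho D_\rho))$. Consider the family of hypersurfaces $X_t=\{tF-\prod_\rho x_\rho=0\}\subset V$, $|t|<1$, and let $\Pi(X_0)$ be its Clemens complex: the abstract simplicial complex with one vertex for each irreducible component of $X_0$, in which a nonempty finite set of components spans a simplex if and only if these components have a common point. Then: 1. every simplex of $\Pi(X_0)$ has dimension at most $n$, and the top rational simplicial homology is one-dimensional, $$H_n(\Pi(X_0),\mathbb{Q})\cong\mathbb{Q};$$ 2. the irreducible components of $X_0$ are exactly the divisors $D_\rho$, without repetition, and $\Pi(X_0)$ is a triangulation of the boundary $\partial\Delta$: there is a homeomorphism from the geometric realization $|\Pi(X_0)|$ onto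 $\partial\Delta$ which sends the point with barycentric coordinates $(p_\rho)_\rho$ to a positive multiple of $\sum_\rho p_\rho\,\rho$; 3. $|\Pi(X_0)|$ is homeomorphic to the sphere $S^n$. -/

import Mathlib

/-! ### Abstract simplicial complexes: simplicial homology, realization, Clemens complex -/

namespace SimplicialHomology

variable {V : Type*}

/-- The boundary of an oriented simplex: vertices are ordered increasingly, and
`∂[v₀, …, vₖ] = ∑ᵢ (-1)ⁱ [v₀, …, v̂ᵢ, …, vₖ]`. The index `i` of `v = vᵢ` is the number of
vertices of the simplex below `v`. The boundary of a vertex is `0` (homology is not reduced). -/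
noncomputable def boundaryOfSimplex [LinearOrder V] (s : Finset V) :
    Finset V →₀ ℚ :=
  if s.card ≤ 1 then 0
  else ∑ v ∈ s, Finsupp.single (s.erase v) ((-1 : ℚ) ^ (s.filter (· < v)).card)

/-- The boundary operator on formal linear combinations of finite vertex sets. -/
noncomputable def boundary [LinearOrder V] :
    (Finset V →₀ ℚ) →ₗ[ℚ] (Finset V →₀ ℚ) :=
  Finsupp.linearCombination ℚ boundaryOfSimplex

/-- Simplicial `k`-chains: formal combinations of the faces with `k + 1` vertices. -/
noncomputable def chains (K : AbstractSimplicialComplex V) (k : ℕ) :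
    Submodule ℚ (Finset V →₀ ℚ) :=
  Finsupp.supported ℚ ℚ {s | s ∈ K.faces ∧ s.card = k + 1}

/-- Simplicial `k`-cycles. -/
noncomputable def cycles [LinearOrder V]
    (K : AbstractSimplicialComplex V) (k : ℕ) : Submodule ℚ (Finset V →₀ ℚ) :=
  chains K k ⊓ LinearMap.ker boundary

/-- Simplicial `k`-boundaries. -/
noncomputable def boundaries [LinearOrder V]
    (K : AbstractSimplicialComplex V) (k : ℕ) : Submodule ℚ (Finset V →₀ ℚ) :=
  (chains K (k + 1)).map boundary

/-- The rational simplicial homology `H_k(K, ℚ)`: cycles modulo boundaries. -/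
abbrev homology [LinearOrder V]
    (K : AbstractSimplicialComplex V) (k : ℕ) : Type _ :=
  cycles K k ⧸ (boundaries K k).submoduleOf (cycles K k)

theorem boundary_boundaryOfSimplex [LinearOrder V] (s : Finset V) :
    boundary (boundaryOfSimplex s) = 0 := by
  unfold boundaryOfSimplex
  split_ifs with h
  · simp
  rw [map_sum]
  by_cases h2 : s.card = 2
  · refine Finset.sum_eq_zero fun v hv => ?_
    have hc : (s.erase v).card ≤ 1 := by rw [Finset.card_erase_of_mem hv]; omega
    simp [boundary, boundaryOfSimplex, hc]
  have key : ∀ v ∈ s, boundary (Finsupp.single (s.erase v)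
      ((-1 : ℚ) ^ (s.filter (· < v)).card)) =
      ∑ w ∈ s.erase v, Finsupp.single ((s.erase v).erase w)
        ((-1 : ℚ) ^ ((s.filter (· < v)).card + ((s.erase v).filter (· < w)).card)) := by
    intro v hv
    have hc : ¬ (s.erase v).card ≤ 1 := by rw [Finset.card_erase_of_mem hv]; omega
    simp [boundary, boundaryOfSimplex, hc, Finset.smul_sum, pow_add]
  rw [Finset.sum_congr rfl key, Finset.sum_sigma']
  have cnt : ∀ v ∈ s, ∀ w ∈ s, v < w →
      (((s.erase v).filter (· < w)).card + 1 = (s.filter (· < w)).card ∧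
        ((s.erase w).filter (· < v)).card = (s.filter (· < v)).card) := by
    intro v hv w hw hvw
    constructor
    · have : (s.erase v).filter (· < w) = (s.filter (· < w)).erase v := by
        ext x; simp; tauto
      rw [this]
      exact Finset.card_erase_add_one (by simp [hv, hvw])
    · congr 1
      ext x
      simp only [Finset.mem_filter, Finset.mem_erase]
      constructor
      · tauto
      · rintro ⟨hx, hxv⟩
        exact ⟨⟨(hxv.trans hvw).ne, hx⟩, hxv⟩
  refine Finset.sum_involution (fun p _ => ⟨p.2, p.1⟩) ?_ ?_ ?_ ?_
  · rintro ⟨v, w⟩ hp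
    simp only [Finset.mem_sigma, Finset.mem_erase] at hp
    obtain ⟨hv, hne, hw⟩ := hp
    have he : (s.erase w).erase v = (s.erase v).erase w := Finset.erase_right_comm
    simp only [he, ← Finsupp.single_add]
    rw [Finsupp.single_eq_zero]
    rcases lt_or_gt_of_ne hne with hlt | hlt
    · obtain ⟨h1, h3⟩ := cnt w hw v hv hlt
      rw [h3, ← h1]; ring
    · obtain ⟨h1, h3⟩ := cnt v hv w hw hlt
      rw [h3, ← h1]; ring
  · rintro ⟨v, w⟩ hp _ heq
    simp only [Finset.mem_sigma, Finset.mem_erase] at hp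
    simp only [Sigma.mk.injEq] at heq
    exact hp.2.1 heq.1
  · rintro ⟨v, w⟩ hp
    simp only [Finset.mem_sigma, Finset.mem_erase] at hp ⊢
    exact ⟨hp.2.2, hp.2.1.symm, hp.1⟩
  · rintro ⟨v, w⟩ _
    rfl

theorem boundaries_le_cycles [LinearOrder V]
    (K : AbstractSimplicialComplex V) (k : ℕ) : boundaries K k ≤ cycles K k := by
  rintro _ ⟨c, hc, rfl⟩
  refine ⟨?_, ?_⟩
  · have hc' := (Finsupp.mem_supported ℚ c).1 hc
    rw [boundary, Finsupp.linearCombination_apply]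
    refine Submodule.sum_mem _ fun s hs => Submodule.smul_mem _ _ ?_
    obtain ⟨hsK, hcard⟩ := hc' hs
    have h1 : ¬ s.card ≤ 1 := by omega
    rw [boundaryOfSimplex, if_neg h1]
    refine Submodule.sum_mem _ fun v hv => Finsupp.single_mem_supported ℚ _ ?_
    have hcv : (s.erase v).card = k + 1 := by
      rw [Finset.card_erase_of_mem hv]; omega
    exact ⟨(K.isRelLowerSet_faces hsK).2 (Finset.erase_subset v s)
      (Finset.card_pos.1 (by omega)), hcv⟩
  · change boundary (boundary c) = 0
    have : boundary ∘ₗ boundary = (0 : (Finset V →₀ ℚ) →ₗ[ℚ] (Finset V →₀ ℚ)) := by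
      refine Finsupp.lhom_ext fun s a => ?_
      have := boundary_boundaryOfSimplex s
      rw [LinearMap.comp_apply]
      conv_lhs => rw [boundary, Finsupp.linearCombination_single, map_smul]
      rw [← boundary, this, smul_zero, LinearMap.zero_apply]
    exact LinearMap.congr_fun this c

end SimplicialHomology

/-- The geometric realization of an abstract simplicial complex with finitely many vertices, placed
in `ℝ^V` with the standard basis vectors as vertices, in barycentric coordinates. -/
def geometricRealization {V : Type*} (K : AbstractSimplicialComplex V) : Set (V → ℝ) :=
  {x | (∀ v, 0 ≤ x v) ∧ ∃ s ∈ K.faces, (∀ v, v ∉ s → x v = 0) ∧ ∑ v ∈ s, x v = 1}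

/-- The Clemens complex `Π(X)` of a space `X`: one vertex for each irreducible component of `X`,
and a finite set of components spans a simplex exactly when the components have a common point. -/
def clemensComplex (X : Type*) [TopologicalSpace X] :
    AbstractSimplicialComplex (irreducibleComponents X) where
  faces := {s | s.Nonempty ∧ (⋂ C ∈ s, (C : Set X)).Nonempty}
  isRelLowerSet_faces := by
    rintro s ⟨hs, x, hx⟩
    refine ⟨hs, fun t hts ht => ⟨ht, x, ?_⟩⟩
    simp only [Set.mem_iInter] at hx ⊢
    exact fun C hC => hx C (hts hC)
  singleton_mem := fun C => ⟨Finset.singleton_nonempty C, by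
    simpa using C.2.prop.nonempty⟩

/-! ### Fans and toric varieties -/

/-- A lattice vector in `ℤ^d`, seen in `ℝ^d`. -/
def latticeToReal {d : ℕ} (u : Fin d → ℤ) : Fin d → ℝ := fun i => (u i : ℝ)

/-- A fan in `ℝ^d` relative to the lattice `ℤ^d`: a finite collection of strongly convex rational
polyhedral cones, closed under faces, in which two cones meet along a face of each. -/
structure ToricFan (d : ℕ) where
  cones : Set (PointedCone ℝ (Fin d → ℝ))
  finite_cones : cones.Finite
  rational : ∀ σ ∈ cones, ∃ S : Finset (Fin d → ℤ),
    σ = PointedCone.hull ℝ (latticeToReal '' (S : Set (Fin d → ℤ)))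
  stronglyConvex : ∀ σ ∈ cones, ∀ x, x ∈ σ → -x ∈ σ → x = 0
  face_mem : ∀ σ ∈ cones, ∀ τ : PointedCone ℝ (Fin d → ℝ), τ.IsFaceOf σ → τ ∈ cones
  inter_isFaceOf : ∀ σ ∈ cones, ∀ τ ∈ cones, (σ ⊓ τ).IsFaceOf σ

namespace ToricFan

variable {d : ℕ} (Φ : ToricFan d)

/-- The fan is complete: its cones cover `ℝ^d`. -/
def IsComplete : Prop := ∀ x : Fin d → ℝ, ∃ σ ∈ Φ.cones, x ∈ σ

/-- The fan is smooth (equivalently, its toric variety is nonsingular): every cone is generated by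
a part of a `ℤ`-basis of the lattice. -/
def IsSmooth : Prop := ∀ σ ∈ Φ.cones, ∃ (b : Module.Basis (Fin d) ℤ (Fin d → ℤ)) (S : Set (Fin d)),
  σ = PointedCone.hull ℝ (latticeToReal '' (b '' S))

/-- The primitive generators of the one-dimensional cones of the fan. They index `Σ(1)`. -/
def rays : Set (Fin d → ℤ) :=
  {u | (∀ (k : ℤ) (w : Fin d → ℤ), u = k • w → IsUnit k) ∧
    PointedCone.hull ℝ {latticeToReal u} ∈ Φ.cones}

theorem eq_of_hull_eq {u v : Fin d → ℤ} (hu : ∀ (k : ℤ) (w : Fin d → ℤ), u = k • w → IsUnit k)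
    (hv : ∀ (k : ℤ) (w : Fin d → ℤ), v = k • w → IsUnit k)
    (h : PointedCone.hull ℝ {latticeToReal u} = PointedCone.hull ℝ {latticeToReal v}) :
    u = v := by
  have h1 : latticeToReal u ∈ PointedCone.hull ℝ {latticeToReal v} :=
    h ▸ PointedCone.subset_hull (Set.mem_singleton _)
  obtain ⟨c, hc⟩ := Submodule.mem_span_singleton.1 h1
  have hci : ∀ i, (c : ℝ) * (v i : ℝ) = u i := fun i => congrFun hc i
  have hv0 : ∃ i, v i ≠ 0 := by
    by_contra hcon
    push Not at hcon
    exact not_isUnit_zero (hv 0 0 (by ext i; simp [hcon i]))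
  have hu0 : ∃ i, u i ≠ 0 := by
    by_contra hcon
    push Not at hcon
    exact not_isUnit_zero (hu 0 0 (by ext i; simp [hcon i]))
  obtain ⟨i, hi⟩ := hv0
  -- the factor is rational: `v i * u = u i * v`
  have hrel : ∀ j, v i * u j = u i * v j := fun j => by
    have : (v i : ℝ) * u j = u i * v j := by rw [← hci i, ← hci j]; ring
    exact_mod_cast this
  have hg : 0 < Int.gcd (v i) (u i) := Int.gcd_pos_of_ne_zero_left _ hi
  obtain ⟨a, ha⟩ : (Int.gcd (v i) (u i) : ℤ) ∣ v i := Int.gcd_dvd_left ..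
  obtain ⟨b, hb⟩ : (Int.gcd (v i) (u i) : ℤ) ∣ u i := Int.gcd_dvd_right ..
  set g : ℤ := (Int.gcd (v i) (u i) : ℤ) with hgdef
  have hg' : g ≠ 0 := by
    have : (0 : ℤ) < g := by rw [hgdef]; exact_mod_cast hg
    exact this.ne'
  have hcop : IsCoprime a b := by
    have hbz : g * (a * Int.gcdA (v i) (u i) + b * Int.gcdB (v i) (u i)) = g * 1 := by
      have := Int.gcd_eq_gcd_ab (v i) (u i)
      rw [← hgdef] at this
      calc _ = (g * a) * Int.gcdA (v i) (u i) + (g * b) * Int.gcdB (v i) (u i) := by ring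
        _ = v i * Int.gcdA (v i) (u i) + u i * Int.gcdB (v i) (u i) := by rw [← ha, ← hb]
        _ = g * 1 := by rw [mul_one]; exact this.symm
    have hbz' := mul_left_cancel₀ hg' hbz
    exact ⟨Int.gcdA (v i) (u i), Int.gcdB (v i) (u i), by linarith⟩
  have hab : ∀ j, a * u j = b * v j := fun j => by
    refine mul_left_cancel₀ hg' ?_
    calc g * (a * u j) = (g * a) * u j := by ring
      _ = (g * b) * v j := by rw [← ha, ← hb]; exact hrel j
      _ = g * (b * v j) := by ring
  have hadvd : ∀ j, a ∣ v j := fun j => hcop.dvd_of_dvd_mul_left ⟨u j, (hab j).symm⟩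
  have hbdvd : ∀ j, b ∣ u j := fun j => hcop.symm.dvd_of_dvd_mul_left ⟨v j, hab j⟩
  choose v' hv' using hadvd
  choose u' hu' using hbdvd
  have ha1 := Int.isUnit_iff.1 (hv a v' (by ext j; simp [hv' j]))
  have hb1 := Int.isUnit_iff.1 (hu b u' (by ext j; simp [hu' j]))
  have huv : u = v ∨ u = -v := by
    rcases ha1 with rfl | rfl <;> rcases hb1 with rfl | rfl
    · left; ext j; have := hab j; linarith
    · right; ext j; have := hab j; simp only [Pi.neg_apply]; linarith
    · right; ext j; have := hab j; simp only [Pi.neg_apply]; linarith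
    · left; ext j; have := hab j; linarith
  rcases huv with huv | huv
  · exact huv
  · exfalso
    obtain ⟨j, hj⟩ := hu0
    have h3 := hci j
    have h4 : (u j : ℝ) = -(v j : ℝ) := by rw [huv]; simp
    have h5 : (v j : ℝ) ≠ 0 := by
      intro h0
      rw [h0, neg_zero] at h4
      exact hj (by exact_mod_cast h4)
    have h6 : (c : ℝ) = -1 := mul_right_cancel₀ h5 (by rw [h3, h4]; ring)
    have := c.2
    linarith

theorem finite_rays : Φ.rays.Finite :=
  Set.Finite.of_injOn (f := fun u => PointedCone.hull ℝ {latticeToReal u})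
    (fun _ hu => hu.2) (fun _ hu _ hv h => eq_of_hull_eq hu.1 hv.1 h) Φ.finite_cones

noncomputable instance : Fintype Φ.rays := Φ.finite_rays.fintype

/-- The open subset of `ℂ^{Σ(1)}` (complement of the irrelevant locus) whose points are the
homogeneous coordinate vectors of points of the toric variety: `x` belongs to it when the rays
`ρ` with `x_ρ = 0` all lie in one cone of the fan. -/
def CoxOpen : Type :=
  {x : Φ.rays → ℂ // ∃ σ ∈ Φ.cones, ∀ ρ : Φ.rays, x ρ = 0 → latticeToReal ρ.1 ∈ σ}

/-- The Zariski topology on the open set, induced from the affine space `ℂ^{Σ(1)}`. -/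
noncomputable instance : TopologicalSpace Φ.CoxOpen :=
  TopologicalSpace.induced
    (fun x => (MvPolynomial.pointToPoint x.1 : PrimeSpectrum (MvPolynomial Φ.rays ℂ)))
    PrimeSpectrum.zariskiTopology

/-- The group `G = Hom(A_{d-1}(V), ℂ^*)` acting on homogeneous coordinates: all `g` with
`∏_ρ g_ρ ^ ⟨m, ρ⟩ = 1` for each `m` in the dual lattice. -/
def coxGroup : Subgroup (Φ.rays → ℂˣ) where
  carrier := {g | ∀ m : Fin d → ℤ, ∏ ρ : Φ.rays, g ρ ^ (∑ i, m i * ρ.1 i) = 1}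
  one_mem' := by intro m; simp
  mul_mem' := by
    intro g h hg hh m
    simp only [Pi.mul_apply, mul_zpow, Finset.prod_mul_distrib]
    rw [hg m, hh m, one_mul]
  inv_mem' := by
    intro g hg m
    simp only [Pi.inv_apply, inv_zpow, Finset.prod_inv_distrib]
    rw [hg m, inv_one]

/-- Two homogeneous coordinate vectors are equivalent when they lie in one `G`-orbit. -/
def coxSetoid : Setoid Φ.CoxOpen where
  r x y := ∃ g ∈ Φ.coxGroup, ∀ ρ, y.1 ρ = (g ρ : ℂ) * x.1 ρ
  iseqv :=
    { refl := fun x => ⟨1, Φ.coxGroup.one_mem, by simp⟩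
      symm := by
        rintro x y ⟨g, hg, h⟩
        exact ⟨g⁻¹, Φ.coxGroup.inv_mem hg, fun ρ => by simp [h ρ]⟩
      trans := by
        rintro x y z ⟨g, hg, h⟩ ⟨g', hg', h'⟩
        exact ⟨g' * g, Φ.coxGroup.mul_mem hg' hg, fun ρ => by simp [h ρ, h' ρ, mul_assoc]⟩ }

/-- The complex toric variety `V = ℙ_Σ` of a smooth complete fan, as the (geometric) quotient of
the space of homogeneous coordinate vectors by `G`. -/
def Variety : Type := Quotient Φ.coxSetoid

/-- The Zariski topology of the toric variety. -/
instance : TopologicalSpace Φ.Variety :=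
  inferInstanceAs (TopologicalSpace (Quotient Φ.coxSetoid))

/-- The point of the toric variety with homogeneous coordinates `x`. -/
def mkPoint (x : Φ.CoxOpen) : Φ.Variety := Quotient.mk Φ.coxSetoid x

/-- The toric divisor `D_ρ`, the zero set of the homogeneous coordinate `x_ρ`. -/
def divisor (ρ : Φ.rays) : Set Φ.Variety := {v | ∃ x, Φ.mkPoint x = v ∧ x.1 ρ = 0}

/-- `F` is a global section of the anticanonical bundle `𝒪(∑_ρ D_ρ)`: an element of the homogeneous
coordinate ring of degree `[∑_ρ D_ρ]`, that is, a linear combination of monomials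
`∏_ρ x_ρ ^ (⟨ν, ρ⟩ + 1)` with `ν` in the dual lattice. -/
def IsAnticanonicalSection (F : MvPolynomial Φ.rays ℂ) : Prop :=
  ∀ e ∈ F.support, ∃ ν : Fin d → ℤ, ∀ ρ : Φ.rays, (e ρ : ℤ) = (∑ i, ν i * ρ.1 i) + 1

/-- The total space of the one-parameter family `t F - ∏_ρ x_ρ = 0` in `V`, over the disk
`|t| < 1`. -/
def family (F : MvPolynomial Φ.rays ℂ) : Set (Φ.Variety × ℂ) :=
  {p | ‖p.2‖ < 1 ∧ ∃ x, Φ.mkPoint x = p.1 ∧ p.2 * MvPolynomial.eval x.1 F - ∏ ρ, x.1 ρ = 0}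

/-- The fibre `X_t` of the family over `t`, with the Zariski topology of a subset of `V`. -/
def fiber (F : MvPolynomial Φ.rays ℂ) (t : ℂ) : Set Φ.Variety := {v | (v, t) ∈ Φ.family F}

/-- The polytope `Δ`, the convex hull of the primitive generators of the rays. -/
def polytope : Set (Fin d → ℝ) := convexHull ℝ (latticeToReal '' Φ.rays)

end ToricFan

/-!
The fibre `X₀` is the union of the toric divisors. In homogeneous coordinates `D_ρ` is a coordinate
hyperplane, so it is closed and irreducible, no `D_ρ` contains another one, and therefore the `D_ρ`
are the irreducible components of `X₀`. By the definition of the irrelevant locus, a set of divisors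
has a common point exactly when the rays lie in a common cone of the fan. So `Π(X₀)` is the complex
of sets of rays of the cones of the fan (`ToricFan.mem_faces_clemensComplex_iff`).

What the remaining argument uses of the fan is the property `IsCompleteSimplicialFan`: taking
nonnegative combinations of the rays is a bijection from the cone over the geometric realization
onto `ℝ^(n+1)`. Completeness gives surjectivity. Smoothness and the condition that cones meet along
faces give injectivity (`ToricFan.isCompleteSimplicialFan`).

Radial projection then identifies the geometric realization with the boundary of any bounded convex
neighbourhood of the origin, since a continuous bijection from a compact space to a Hausdorff space
is a homeomorphism (`IsCompleteSimplicialFan.exists_homeomorph_frontier`). The polytope `Δ` and the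
Euclidean ball are two such neighbourhoods.

For the homology, the generators in a face are linearly independent, so there are no simplices above
dimension `n` and `H_n` is the space of `n`-cycles. A facet with its vertices in increasing order is
a basis of `ℝ^(n+1)`, whose determinant gives it a sign. A ridge lies in exactly two facets, one on
each side of its hyperplane, and Laplace expansion shows that the coefficient of a boundary at the
ridge is, up to sign, the difference of the sign-corrected coefficients of the two facets
(`IsCompleteSimplicialFan.exists_boundary_apply_eq`). Hence the sum of all facets with their signs
is a cycle. Conversely, two facets are joined by a generic line, which avoids all cones of codimension
at least two, so that the sign-corrected coefficients of a cycle are constant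
(`IsCompleteSimplicialFan.cycle_eq`).
-/

open scoped Topology

/-! ### Toric divisors as irreducible components -/

theorem pointToPoint_mem_basicOpen {σ : Type*} (x : σ → ℂ) (f : MvPolynomial σ ℂ) :
    (MvPolynomial.pointToPoint x : PrimeSpectrum (MvPolynomial σ ℂ)) ∈
      PrimeSpectrum.basicOpen f ↔ MvPolynomial.eval x f ≠ 0 := by
  rw [PrimeSpectrum.mem_basicOpen]
  refine not_congr ?_
  change f ∈ MvPolynomial.vanishingIdeal ℂ {x} ↔ _
  rw [MvPolynomial.mem_vanishingIdeal_singleton_iff, MvPolynomial.aeval_eq_eval]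

/-- A finite cover by closed irreducible sets without inclusions is the list of irreducible
components. -/
theorem exists_equiv_irreducibleComponents {X ι : Type*} [TopologicalSpace X] [Finite ι]
    (D : ι → Set X) (hcl : ∀ i, IsClosed (D i)) (hirr : ∀ i, IsIrreducible (D i))
    (hcov : ⋃ i, D i = Set.univ) (hsub : ∀ i j, D i ⊆ D j → i = j) :
    ∃ e : ι ≃ irreducibleComponents X, ∀ i, (e i : Set X) = D i := by
  have hle : ∀ Z : Set X, IsIrreducible Z → ∃ i, Z ⊆ D i := by
    intro Z hZ
    obtain ⟨W, hW, hZW⟩ := isIrreducible_iff_sUnion_isClosed.1 hZ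
      (Set.finite_range D).toFinset (by simpa using hcl)
      (by simp [hcov])
    obtain ⟨i, rfl⟩ : ∃ i, D i = W := by simpa using hW
    exact ⟨i, hZW⟩
  have hmem : ∀ i, D i ∈ irreducibleComponents X := fun i => ⟨hirr i, fun Z hZ hi => by
    obtain ⟨j, hj⟩ := hle Z hZ
    rw [hsub i j (hi.trans hj)]
    exact hj⟩
  refine ⟨Equiv.ofBijective (fun i => ⟨D i, hmem i⟩) ⟨fun i j h => ?_, fun Z => ?_⟩,
    fun i => rfl⟩
  · exact hsub i j (Subtype.ext_iff.1 h).le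
  · obtain ⟨i, hi⟩ := hle Z.1 Z.2.prop
    exact ⟨i, Subtype.ext (Set.Subset.antisymm (Z.2.2 (hirr i) hi) hi)⟩

namespace ToricFan

section Cox

variable {d : ℕ} (Φ : ToricFan d)

theorem mkPoint_eq_iff {x y : Φ.CoxOpen} :
    Φ.mkPoint x = Φ.mkPoint y ↔ ∃ g ∈ Φ.coxGroup, ∀ ρ, y.1 ρ = (g ρ : ℂ) * x.1 ρ :=
  Quotient.eq (r := Φ.coxSetoid)

theorem mkPoint_surjective : Function.Surjective Φ.mkPoint := Quotient.mk_surjective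

theorem mkPoint_mem_divisor {x : Φ.CoxOpen} {ρ : Φ.rays} :
    Φ.mkPoint x ∈ Φ.divisor ρ ↔ x.1 ρ = 0 := by
  refine ⟨?_, fun h => ⟨x, rfl, h⟩⟩
  rintro ⟨y, hy, hy0⟩
  obtain ⟨g, -, hg⟩ := (Φ.mkPoint_eq_iff).1 hy
  rw [hg, hy0, mul_zero]

theorem continuous_mkPoint : Continuous Φ.mkPoint := continuous_quot_mk

theorem isClosed_divisor (ρ : Φ.rays) : IsClosed (Φ.divisor ρ) := by
  have hq : Topology.IsQuotientMap Φ.mkPoint := isQuotientMap_quot_mk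
  rw [← hq.isClosed_preimage, ← isOpen_compl_iff]
  have hc : Continuous fun x : Φ.CoxOpen =>
    (MvPolynomial.pointToPoint x.1 : PrimeSpectrum (MvPolynomial Φ.rays ℂ)) :=
    continuous_induced_dom
  convert (PrimeSpectrum.isOpen_basicOpen (a := MvPolynomial.X ρ)).preimage hc using 1
  ext x
  change ¬ (Φ.mkPoint x ∈ Φ.divisor ρ) ↔ MvPolynomial.pointToPoint x.1 ∈ PrimeSpectrum.basicOpen _
  rw [pointToPoint_mem_basicOpen, mkPoint_mem_divisor, MvPolynomial.eval_X]

/-- Principal open sets form a basis of the Zariski topology on the homogeneous coordinates. -/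
theorem exists_eval_ne_zero_of_mem_isOpen {u : Set Φ.CoxOpen} (hu : IsOpen u) {x : Φ.CoxOpen}
    (hx : x ∈ u) : ∃ f : MvPolynomial Φ.rays ℂ, MvPolynomial.eval x.1 f ≠ 0 ∧
      ∀ y : Φ.CoxOpen, MvPolynomial.eval y.1 f ≠ 0 → y ∈ u := by
  obtain ⟨U, hU, rfl⟩ := isOpen_induced_iff.1 hu
  obtain ⟨_, ⟨f, rfl⟩, hf, hfU⟩ :=
    PrimeSpectrum.isTopologicalBasis_basic_opens.exists_subset_of_mem_open hx hU
  exact ⟨f, (pointToPoint_mem_basicOpen _ _).1 hf,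
    fun y hy => hfU ((pointToPoint_mem_basicOpen _ _).2 hy)⟩

variable {Φ} in
/-- The homogeneous coordinate vector that vanishes exactly on the rays of a cone. -/
theorem exists_coxOpen_eq_zero_iff {σ : PointedCone ℝ (Fin d → ℝ)} (hσ : σ ∈ Φ.cones) :
    ∃ x : Φ.CoxOpen, ∀ ρ : Φ.rays, x.1 ρ = 0 ↔ latticeToReal ρ.1 ∈ σ := by
  classical
  have key : ∀ ρ : Φ.rays, (if latticeToReal ρ.1 ∈ σ then (0 : ℂ) else 1) = 0 ↔
      latticeToReal ρ.1 ∈ σ := fun ρ => by split_ifs with h <;> simp [h]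
  exact ⟨⟨fun ρ => if latticeToReal ρ.1 ∈ σ then 0 else 1, σ, hσ, fun ρ => (key ρ).1⟩, key⟩

theorem latticeToReal_injective : Function.Injective (latticeToReal (d := d)) :=
  fun u v h => funext fun i => by
    have := congrFun h i
    simpa [latticeToReal] using this

theorem ray_eq_of_mem_hull {ρ ρ' : Φ.rays}
    (h : latticeToReal ρ'.1 ∈ PointedCone.hull ℝ {latticeToReal ρ.1}) : ρ' = ρ := by
  refine Subtype.ext (eq_of_hull_eq ρ'.2.1 ρ.2.1 ?_)
  obtain ⟨c, hc⟩ := Submodule.mem_span_singleton.1 h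
  have hc0 : c ≠ 0 := by
    rintro rfl
    rw [zero_smul] at hc
    have h0 : ρ'.1 = 0 := latticeToReal_injective (by
      rw [← hc]; ext i; simp [latticeToReal])
    exact not_isUnit_zero (ρ'.2.1 0 0 (by simp [h0]))
  rw [← hc]
  exact Submodule.span_singleton_smul_eq (IsUnit.mk0 c hc0) _

theorem isIrreducible_divisor (ρ : Φ.rays) : IsIrreducible (Φ.divisor ρ) := by
  classical
  have himg : Φ.divisor ρ = Φ.mkPoint '' {x | x.1 ρ = 0} := by
    ext v
    constructor
    · rintro ⟨x, rfl, hx⟩; exact ⟨x, hx, rfl⟩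
    · rintro ⟨x, hx, rfl⟩; exact ⟨x, rfl, hx⟩
  rw [himg]
  refine IsIrreducible.image ⟨?_, ?_⟩ _ Φ.continuous_mkPoint.continuousOn
  · obtain ⟨x, hx⟩ := exists_coxOpen_eq_zero_iff ρ.2.2
    exact ⟨x, (hx ρ).2 (PointedCone.subset_hull (Set.mem_singleton _))⟩
  rintro u v hu hv ⟨x, hx0, hxu⟩ ⟨y, hy0, hyv⟩
  obtain ⟨f, hfx, hf⟩ := Φ.exists_eval_ne_zero_of_mem_isOpen hu hxu
  obtain ⟨g, hgy, hg⟩ := Φ.exists_eval_ne_zero_of_mem_isOpen hv hyv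
  -- Restricting polynomials to the hyperplane `x_ρ = 0`; the remaining coordinates must be kept
  -- nonzero so as to stay in the complement of the irrelevant locus.
  let r : MvPolynomial Φ.rays ℂ →ₐ[ℂ] MvPolynomial Φ.rays ℂ :=
    MvPolynomial.aeval fun ρ' => if ρ' = ρ then 0 else MvPolynomial.X ρ'
  have hr : ∀ (z : Φ.rays → ℂ) (p : MvPolynomial Φ.rays ℂ),
      MvPolynomial.eval z (r p) = MvPolynomial.eval (Function.update z ρ 0) p := by
    intro z p
    have : (MvPolynomial.aeval z).comp r = MvPolynomial.aeval (Function.update z ρ 0) := by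
      refine MvPolynomial.algHom_ext fun ρ' => ?_
      by_cases h : ρ' = ρ
      · subst h; simp [r]
      · simp [r, h]
    have := DFunLike.congr_fun this p
    simpa [MvPolynomial.aeval_eq_eval] using this
  have hne : ∀ (z : Φ.CoxOpen) (p : MvPolynomial Φ.rays ℂ), z.1 ρ = 0 →
      MvPolynomial.eval z.1 p ≠ 0 → r p ≠ 0 := by
    intro z p hz hp h0
    apply hp
    have := hr z.1 p
    rw [h0, map_zero, (Function.update_eq_self_iff.2 hz.symm : Function.update z.1 ρ 0 = z.1)]
      at this
    exact this.symm
  have hprod : r f * r g * ∏ ρ' : Φ.rays, MvPolynomial.X ρ' ≠ 0 :=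
    mul_ne_zero (mul_ne_zero (hne x f hx0 hfx) (hne y g hy0 hgy))
      (Finset.prod_ne_zero_iff.2 fun ρ' _ => MvPolynomial.X_ne_zero ρ')
  obtain ⟨z, hz⟩ : ∃ z : Φ.rays → ℂ, MvPolynomial.eval z
      (r f * r g * ∏ ρ' : Φ.rays, MvPolynomial.X ρ') ≠ 0 := by
    by_contra! hcon
    exact hprod (MvPolynomial.funext fun z => by rw [hcon z, map_zero])
  rw [map_mul, map_mul, hr, hr, map_prod] at hz
  simp only [MvPolynomial.eval_X] at hz
  have hzX := Finset.prod_ne_zero_iff.1 (right_ne_zero_of_mul hz)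
  refine ⟨⟨Function.update z ρ 0, _, ρ.2.2, fun ρ' h => ?_⟩, Function.update_self .., ?_, ?_⟩
  · by_cases hρ : ρ' = ρ
    · rw [hρ]; exact PointedCone.subset_hull (Set.mem_singleton _)
    · rw [Function.update_of_ne hρ] at h
      exact absurd h (hzX ρ' (Finset.mem_univ _))
  · exact hf _ (left_ne_zero_of_mul (left_ne_zero_of_mul hz))
  · exact hg _ (right_ne_zero_of_mul (left_ne_zero_of_mul hz))

theorem eq_of_divisor_subset {ρ ρ' : Φ.rays} (h : Φ.divisor ρ ⊆ Φ.divisor ρ') : ρ = ρ' := by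
  obtain ⟨x, hx⟩ := exists_coxOpen_eq_zero_iff ρ.2.2
  have h1 : x.1 ρ = 0 := (hx ρ).2 (PointedCone.subset_hull (Set.mem_singleton _))
  have h2 := Φ.mkPoint_mem_divisor.1 (h (Φ.mkPoint_mem_divisor.2 h1))
  exact (Φ.ray_eq_of_mem_hull ((hx ρ').1 h2)).symm

theorem fiber_zero (F : MvPolynomial Φ.rays ℂ) : Φ.fiber F 0 = ⋃ ρ, Φ.divisor ρ := by
  ext v
  obtain ⟨x, rfl⟩ := Φ.mkPoint_surjective v
  simp only [Set.mem_iUnion, mkPoint_mem_divisor]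
  constructor
  · rintro ⟨-, y, hy, h⟩
    rw [zero_mul, zero_sub, neg_eq_zero, Finset.prod_eq_zero_iff] at h
    obtain ⟨ρ, -, hρ⟩ := h
    have hy' : Φ.mkPoint y = Φ.mkPoint x := hy
    exact ⟨ρ, Φ.mkPoint_mem_divisor.1 (hy' ▸ Φ.mkPoint_mem_divisor.2 hρ)⟩
  · rintro ⟨ρ, hρ⟩
    refine ⟨by simp, x, rfl, ?_⟩
    rw [zero_mul, zero_sub, neg_eq_zero]
    exact Finset.prod_eq_zero (Finset.mem_univ ρ) hρ

theorem exists_equiv_components_fiber_zero (F : MvPolynomial Φ.rays ℂ) :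
    ∃ e : Φ.rays ≃ irreducibleComponents (Φ.fiber F 0),
      ∀ ρ, (e ρ : Set (Φ.fiber F 0)) = Subtype.val ⁻¹' Φ.divisor ρ := by
  have hsub : ∀ ρ, Φ.divisor ρ ⊆ Φ.fiber F 0 := fun ρ => by
    rw [fiber_zero]; exact Set.subset_iUnion _ ρ
  refine exists_equiv_irreducibleComponents _
    (fun ρ => (Φ.isClosed_divisor ρ).preimage continuous_subtype_val) (fun ρ => ?_) ?_ ?_
  · refine ⟨?_, ?_⟩
    · obtain ⟨v, hv⟩ := (Φ.isIrreducible_divisor ρ).1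
      exact ⟨⟨v, hsub ρ hv⟩, hv⟩
    · rintro u v hu hv ⟨x, hx, hxu⟩ ⟨y, hy, hyv⟩
      obtain ⟨U, hU, rfl⟩ := isOpen_induced_iff.1 hu
      obtain ⟨W, hW, rfl⟩ := isOpen_induced_iff.1 hv
      obtain ⟨z, hz, hzUW⟩ :=
        (Φ.isIrreducible_divisor ρ).2 U W hU hW ⟨x, hx, hxu⟩ ⟨y, hy, hyv⟩
      exact ⟨⟨z, hsub ρ hz⟩, hz, hzUW⟩
  · refine Set.eq_univ_of_forall fun v => ?_
    have hv : v.1 ∈ ⋃ ρ, Φ.divisor ρ := Φ.fiber_zero F ▸ v.2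
    simpa using hv
  · intro ρ ρ' h
    exact Φ.eq_of_divisor_subset fun v hv => @h ⟨v, hsub ρ hv⟩ hv

/-- Toric divisors have a common point exactly when their rays lie in a common cone. -/
theorem mem_faces_clemensComplex_iff (F : MvPolynomial Φ.rays ℂ)
    {e : Φ.rays ≃ irreducibleComponents (Φ.fiber F 0)}
    (he : ∀ ρ, (e ρ : Set (Φ.fiber F 0)) = Subtype.val ⁻¹' Φ.divisor ρ)
    (s : Finset (irreducibleComponents (Φ.fiber F 0))) :
    s ∈ (clemensComplex (Φ.fiber F 0)).faces ↔
      s.Nonempty ∧ ∃ σ ∈ Φ.cones, ∀ C ∈ s, latticeToReal (e.symm C).1 ∈ σ := by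
  have hmem : ∀ (C : irreducibleComponents (Φ.fiber F 0)) (v : Φ.fiber F 0),
      v ∈ (C : Set (Φ.fiber F 0)) ↔ v.1 ∈ Φ.divisor (e.symm C) := fun C v => by
    conv_lhs => rw [← e.apply_symm_apply C, he]
    rfl
  refine and_congr_right fun hs => ⟨?_, ?_⟩
  · rintro ⟨v, hv⟩
    simp only [Set.mem_iInter, hmem] at hv
    obtain ⟨x, hx⟩ := Φ.mkPoint_surjective v.1
    obtain ⟨σ, hσ, h⟩ := x.2
    refine ⟨σ, hσ, fun C hC => h _ ?_⟩
    have := hv C hC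
    rwa [← hx, mkPoint_mem_divisor] at this
  · rintro ⟨σ, hσ, h⟩
    obtain ⟨x, hx⟩ := exists_coxOpen_eq_zero_iff hσ
    have hD : ∀ C ∈ s, Φ.mkPoint x ∈ Φ.divisor (e.symm C) := fun C hC =>
      Φ.mkPoint_mem_divisor.2 ((hx _).2 (h C hC))
    obtain ⟨C, hC⟩ := hs
    refine ⟨⟨Φ.mkPoint x, ?_⟩, ?_⟩
    · rw [fiber_zero]; exact Set.mem_iUnion.2 ⟨_, hD C hC⟩
    · simp only [Set.mem_iInter, hmem]
      exact hD

end Cox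

/-! ### Smooth cones and their rays -/

section Cones

variable {d : ℕ}

/-- The real coordinates on `ℝ^d` with respect to a `ℤ`-basis of the lattice `ℤ^d`. -/
noncomputable def realCoord (b : Module.Basis (Fin d) ℤ (Fin d → ℤ)) (k : Fin d) :
    (Fin d → ℝ) →ₗ[ℝ] ℝ :=
  Fintype.linearCombination ℝ fun j => (b.repr (Pi.single j 1) k : ℝ)

theorem realCoord_latticeToReal (b : Module.Basis (Fin d) ℤ (Fin d → ℤ)) (k : Fin d)
    (u : Fin d → ℤ) : realCoord b k (latticeToReal u) = b.repr u k := by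
  have hu : u = ∑ j, u j • Pi.single j (1 : ℤ) := by
    ext i; simp [Finset.sum_apply, Pi.single_apply]
  conv_rhs => rw [hu, map_sum]
  simp only [map_smul]
  simp [realCoord, Fintype.linearCombination_apply, latticeToReal]

theorem realCoord_basis (b : Module.Basis (Fin d) ℤ (Fin d → ℤ)) (k i : Fin d) :
    realCoord b k (latticeToReal (b i)) = if i = k then 1 else 0 := by
  rw [realCoord_latticeToReal, b.repr_self, Finsupp.single_apply]
  split_ifs <;> simp

theorem sum_realCoord_smul (b : Module.Basis (Fin d) ℤ (Fin d → ℤ)) (x : Fin d → ℝ) :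
    ∑ k, realCoord b k x • latticeToReal (b k) = x := by
  have : (∑ k, (realCoord b k).smulRight (latticeToReal (b k))) =
      (LinearMap.id : (Fin d → ℝ) →ₗ[ℝ] (Fin d → ℝ)) := by
    refine (Pi.basisFun ℝ (Fin d)).ext fun j => ?_
    have h1 : (Pi.basisFun ℝ (Fin d)) j = latticeToReal (Pi.single j 1) := by
      ext i; simp [latticeToReal, Pi.single_apply]
    rw [h1]
    ext i
    have h2 := congrFun (b.sum_repr (Pi.single j 1)) i
    simp only [LinearMap.sum_apply, LinearMap.smulRight_apply, realCoord_latticeToReal,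
      LinearMap.id_apply, Finset.sum_apply, Pi.smul_apply, smul_eq_mul] at h2 ⊢
    simp only [latticeToReal]
    exact_mod_cast h2
  have h := LinearMap.congr_fun this x
  simpa using h

theorem mem_hull_basis_iff (b : Module.Basis (Fin d) ℤ (Fin d → ℤ)) (S : Set (Fin d))
    (x : Fin d → ℝ) : x ∈ PointedCone.hull ℝ (latticeToReal '' (b '' S)) ↔
      (∀ k, 0 ≤ realCoord b k x) ∧ ∀ k ∉ S, realCoord b k x = 0 := by
  constructor
  · intro hx
    induction hx using Submodule.span_induction with
    | mem x hx =>
      obtain ⟨_, ⟨i, hi, rfl⟩, rfl⟩ := hx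
      simp only [realCoord_basis]
      refine ⟨fun k => by split_ifs <;> simp, fun k hk => if_neg ?_⟩
      rintro rfl
      exact hk hi
    | zero => simp
    | add x y _ _ hx hy =>
      simp only [map_add]
      exact ⟨fun k => add_nonneg (hx.1 k) (hy.1 k),
        fun k hk => by rw [hx.2 k hk, hy.2 k hk, add_zero]⟩
    | smul c x _ hx =>
      have : ∀ k, realCoord b k (c • x) = (c : ℝ) * realCoord b k x := fun k =>
        (realCoord b k).map_smul (c : ℝ) x
      simp only [this]
      exact ⟨fun k => mul_nonneg c.2 (hx.1 k), fun k hk => by rw [hx.2 k hk, mul_zero]⟩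
  · rintro ⟨h1, h2⟩
    rw [← sum_realCoord_smul b x]
    refine Submodule.sum_mem _ fun k _ => ?_
    by_cases hk : k ∈ S
    · exact Submodule.smul_mem _ (⟨_, h1 k⟩ : {c : ℝ // 0 ≤ c})
        (PointedCone.subset_hull ⟨_, ⟨k, hk, rfl⟩, rfl⟩)
    · rw [h2 k hk, zero_smul]
      exact Submodule.zero_mem _

theorem isUnit_of_basis_eq_smul (b : Module.Basis (Fin d) ℤ (Fin d → ℤ)) (i : Fin d)
    (k : ℤ) (w : Fin d → ℤ) (h : b i = k • w) : IsUnit k := by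
  have := congrArg (fun u => b.repr u i) h
  simp only [Module.Basis.repr_self, Finsupp.single_eq_same, map_smul, Finsupp.smul_apply,
    smul_eq_mul] at this
  exact IsUnit.of_mul_eq_one _ this.symm

variable {Φ : ToricFan d}

/-- The generators of a smooth cone of the fan span faces of it, so they are rays of the fan. -/
theorem basis_mem_rays {b : Module.Basis (Fin d) ℤ (Fin d → ℤ)} {S : Set (Fin d)}
    (hσ : PointedCone.hull ℝ (latticeToReal '' (b '' S)) ∈ Φ.cones) {i : Fin d} (hi : i ∈ S) :
    b i ∈ Φ.rays := by
  refine ⟨isUnit_of_basis_eq_smul b i, Φ.face_mem _ hσ _ ?_⟩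
  have hs : ({latticeToReal (b i)} : Set (Fin d → ℝ)) = latticeToReal '' (b '' {i}) := by simp
  rw [hs]
  constructor
  · exact Submodule.span_mono (by gcongr; simpa using hi)
  · intro x y a hx hy ha hxy
    rw [mem_hull_basis_iff] at *
    refine ⟨hx.1, fun k hk => ?_⟩
    have := hxy.2 k hk
    rw [map_add, map_smul, smul_eq_mul] at this
    have h1 := hx.1 k
    have h2 := hy.1 k
    have h3 : a * realCoord b k x = 0 := by nlinarith [mul_nonneg ha.le h1]
    exact (mul_eq_zero.1 h3).resolve_left ha.ne'

/-- The rays of the fan contained in a smooth cone are among its generators. -/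
theorem exists_basis_eq_of_mem_rays {b : Module.Basis (Fin d) ℤ (Fin d → ℤ)} {S : Set (Fin d)}
    (hσ : PointedCone.hull ℝ (latticeToReal '' (b '' S)) ∈ Φ.cones) (ρ : Φ.rays)
    (hρ : latticeToReal ρ.1 ∈ PointedCone.hull ℝ (latticeToReal '' (b '' S))) :
    ∃ i ∈ S, b i = ρ.1 := by
  have hρ' := (mem_hull_basis_iff b S _).1 hρ
  obtain ⟨i, hi⟩ : ∃ i, realCoord b i (latticeToReal ρ.1) ≠ 0 := by
    by_contra! hcon
    have h0 : latticeToReal ρ.1 = latticeToReal 0 := by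
      rw [← sum_realCoord_smul b (latticeToReal ρ.1)]
      ext i
      simp [hcon, latticeToReal]
    exact not_isUnit_zero (ρ.2.1 0 0 (by simp [latticeToReal_injective h0]))
  have hiS : i ∈ S := by
    by_contra h
    exact hi (hρ'.2 i h)
  refine ⟨i, hiS, ?_⟩
  have hface := Φ.inter_isFaceOf _ hσ _ ρ.2.2
  have hmem := hface.mem_of_smul_add_mem (x := latticeToReal (b i))
    (y := latticeToReal ρ.1 - realCoord b i (latticeToReal ρ.1) • latticeToReal (b i))
    (a := realCoord b i (latticeToReal ρ.1))
    (PointedCone.subset_hull ⟨_, ⟨i, hiS, rfl⟩, rfl⟩)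
    ((mem_hull_basis_iff _ _ _).2 (by
      simp only [map_sub, map_smul, smul_eq_mul, realCoord_basis]
      refine ⟨fun k => ?_, fun k hk => ?_⟩
      · split_ifs with h
        · simp [h]
        · simpa using hρ'.1 k
      · rw [if_neg (by rintro rfl; exact hk hiS), hρ'.2 k hk]; simp))
    (lt_of_le_of_ne (hρ'.1 i) (Ne.symm hi))
    (by rw [add_sub_cancel]; exact ⟨hρ, PointedCone.subset_hull (Set.mem_singleton _)⟩)
  exact congrArg Subtype.val
    (Φ.ray_eq_of_mem_hull (ρ' := ⟨b i, basis_mem_rays hσ hiS⟩) hmem.2)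

end Cones

end ToricFan

/-! ### Complete simplicial fans -/

/-- The points of the first orthant of `ℝ^V` that are supported on a face of `K`: the union of the
cones, with apex the origin, over the simplices of the geometric realization of `K`. -/
def conicalRealization {V : Type*} (K : AbstractSimplicialComplex V) : Set (V → ℝ) :=
  {p | (∀ v, 0 ≤ p v) ∧ ∃ s ∈ K.faces, ∀ v ∉ s, p v = 0}

/-- The vectors `w v` generate a complete simplicial fan whose cones are spanned by the faces of
`K`: every vector is, in exactly one way, a nonnegative combination of the vectors in a face. The
existence is the completeness, the uniqueness says that the cones are simplicial and meet along
common faces. -/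
def IsCompleteSimplicialFan {V E : Type*} [Fintype V] [AddCommGroup E] [Module ℝ E]
    (K : AbstractSimplicialComplex V) (w : V → E) : Prop :=
  Set.BijOn (Fintype.linearCombination ℝ w) (conicalRealization K) Set.univ

namespace ToricFan

/-- A smooth complete fan, described by its rays and by the sets of rays in a common cone. -/
theorem isCompleteSimplicialFan {d : ℕ} (hd : 0 < d) (Φ : ToricFan d) (hsmooth : Φ.IsSmooth)
    (hcomplete : Φ.IsComplete) {V : Type*} [Fintype V] (r : V ≃ Φ.rays)
    (K : AbstractSimplicialComplex V)
    (hK : ∀ s, s ∈ K.faces ↔ s.Nonempty ∧ ∃ σ ∈ Φ.cones, ∀ v ∈ s, latticeToReal (r v).1 ∈ σ) :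
    IsCompleteSimplicialFan K (fun v => latticeToReal (r v).1) := by
  classical
  set w : V → Fin d → ℝ := fun v => latticeToReal (r v).1
  have hw : ∀ v, w v = latticeToReal (r v).1 := fun _ => rfl
  refine ⟨fun _ _ => Set.mem_univ _, ?_, ?_⟩
  · -- both representations are supported on the generators of the intersection of two cones
    have hface : ∀ p ∈ conicalRealization K, ∃ σ ∈ Φ.cones,
        Fintype.linearCombination ℝ w p ∈ σ ∧ ∀ τ ∈ Φ.cones,
          Fintype.linearCombination ℝ w p ∈ τ → ∀ v, p v ≠ 0 → w v ∈ σ ∧ w v ∈ τ := by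
      rintro p ⟨hp, s, hs, hps⟩
      obtain ⟨-, σ, hσ, hsσ⟩ := (hK s).1 hs
      have hterm : ∀ v, p v • w v ∈ σ := fun v => by
        by_cases hv : v ∈ s
        · exact σ.smul_mem (hp v) (hsσ v hv)
        · rw [hps v hv, zero_smul]; exact σ.zero_mem
      have hLσ : Fintype.linearCombination ℝ w p ∈ σ := by
        rw [Fintype.linearCombination_apply]
        exact Submodule.sum_mem _ fun v _ => hterm v
      refine ⟨σ, hσ, hLσ, fun τ hτ hLτ v hv => ?_⟩
      refine (Φ.inter_isFaceOf σ hσ τ hτ).mem_of_smul_add_mem (x := w v)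
        (y := ∑ u ∈ Finset.univ.erase v, p u • w u) (a := p v)
        (hsσ v (by_contra fun h => hv (hps v h))) (Submodule.sum_mem _ fun u _ => hterm u)
        (lt_of_le_of_ne (hp v) (Ne.symm hv)) ?_
      rw [Finset.add_sum_erase _ (fun u => p u • w u) (Finset.mem_univ v),
        ← Fintype.linearCombination_apply]
      exact ⟨hLσ, hLτ⟩
    intro p hp q hq hpq
    obtain ⟨σ, hσ, hpσ, hp'⟩ := hface p hp
    obtain ⟨τ, hτ, hqτ, hq'⟩ := hface q hq
    have hpsupp : ∀ v, p v ≠ 0 → w v ∈ σ := fun v hv => (hp' τ hτ (hpq ▸ hqτ) v hv).1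
    have hqsupp : ∀ v, q v ≠ 0 → w v ∈ σ := fun v hv => (hq' σ hσ (hpq ▸ hpσ) v hv).2
    obtain ⟨b, S, rfl⟩ := hsmooth σ hσ
    have hcoord : ∀ v k, b k = (r v).1 → ∀ f : V → ℝ,
        (∀ u, f u ≠ 0 → w u ∈ PointedCone.hull ℝ (latticeToReal '' (b '' S))) →
        realCoord b k (Fintype.linearCombination ℝ w f) = f v := by
      intro v k hk f hf
      rw [Fintype.linearCombination_apply, map_sum, Finset.sum_eq_single v]
      · rw [map_smul, hw, ← hk, realCoord_basis, if_pos rfl, smul_eq_mul, mul_one]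
      · intro u _ huv
        rw [map_smul]
        by_cases hfu : f u = 0
        · rw [hfu, zero_smul]
        obtain ⟨i, -, hi⟩ := exists_basis_eq_of_mem_rays hσ (r u) (hf u hfu)
        rw [hw, ← hi, realCoord_basis, if_neg, smul_zero]
        rintro rfl
        exact huv (r.injective (Subtype.ext (hi.symm.trans hk)))
      · simp
    funext v
    by_cases hv : w v ∈ PointedCone.hull ℝ (latticeToReal '' (b '' S))
    · obtain ⟨k, -, hk⟩ := exists_basis_eq_of_mem_rays hσ (r v) hv
      rw [← hcoord v k hk p hpsupp, ← hcoord v k hk q hqsupp, hpq]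
    · rw [of_not_not (mt (hpsupp v) hv), of_not_not (mt (hqsupp v) hv)]
  · have hsurj : ∀ x : Fin d → ℝ, x ≠ 0 →
        x ∈ Fintype.linearCombination ℝ w '' conicalRealization K := by
      intro x hx
      obtain ⟨σ, hσ, hxσ⟩ := hcomplete x
      obtain ⟨b, S, rfl⟩ := hsmooth σ hσ
      obtain ⟨h1, h2⟩ := (mem_hull_basis_iff b S x).1 hxσ
      let g : S → V := fun k => r.symm ⟨b k, basis_mem_rays hσ k.2⟩
      have hg : ∀ k, w (g k) = latticeToReal (b k) := fun k => by simp [g, hw]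
      refine ⟨∑ k : S, realCoord b k x • Pi.single (g k) (1 : ℝ), ⟨fun v => ?_, ?_⟩, ?_⟩
      · rw [Finset.sum_apply]
        refine Finset.sum_nonneg fun k _ => mul_nonneg (h1 k) ?_
        by_cases h : v = g k
        · subst h; simp
        · simp [h]
      · refine ⟨Finset.univ.image g, (hK _).2 ⟨?_, _, hσ, ?_⟩, fun v hv => ?_⟩
        · rw [Finset.image_nonempty, Finset.univ_nonempty_iff]
          by_contra hS
          apply hx
          rw [← sum_realCoord_smul b x]
          exact Finset.sum_eq_zero fun k _ => by
            rw [h2 k fun hk => hS ⟨k, hk⟩, zero_smul]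
        · intro v hv
          obtain ⟨k, -, rfl⟩ := Finset.mem_image.1 hv
          change w (g k) ∈ _
          rw [hg]
          exact PointedCone.subset_hull ⟨_, ⟨k, k.2, rfl⟩, rfl⟩
        · rw [Finset.sum_apply]
          refine Finset.sum_eq_zero fun k _ => ?_
          have : v ≠ g k := by
            rintro rfl
            exact hv (Finset.mem_image_of_mem _ (Finset.mem_univ _))
          simp [this]
      · rw [map_sum]
        conv_rhs => rw [← sum_realCoord_smul b x]
        rw [← Finset.sum_subset (Finset.subset_univ (Finset.univ.filter (· ∈ S))) fun k _ hk => by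
          rw [h2 k (by simpa using hk), zero_smul]]
        rw [Finset.sum_subtype (p := (· ∈ S)) (Finset.univ.filter (· ∈ S)) (by simp)]
        refine Finset.sum_congr rfl fun k _ => ?_
        rw [map_smul, Fintype.linearCombination_apply_single, one_smul, hg]
    intro x _
    by_cases hx : x = 0
    · obtain ⟨p, ⟨-, s, hs, -⟩, -⟩ := hsurj (fun _ => 1) fun h =>
        one_ne_zero (α := ℝ) (congrFun h ⟨0, hd⟩)
      exact ⟨0, ⟨fun _ => le_rfl, s, hs, fun _ _ => rfl⟩, by rw [map_zero, hx]⟩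
    · exact hsurj x hx

end ToricFan

/-! ### Radial projection of the geometric realization -/

section Realization

theorem smul_mem_conicalRealization {V : Type*} {K : AbstractSimplicialComplex V}
    {p : V → ℝ} (hp : p ∈ conicalRealization K) {c : ℝ}
    (hc : 0 ≤ c) : c • p ∈ conicalRealization K := by
  obtain ⟨hp, s, hs, hps⟩ := hp
  exact ⟨fun v => mul_nonneg hc (hp v), s, hs, fun v hv => by simp [hps v hv]⟩

variable {V : Type*} [Fintype V] {K : AbstractSimplicialComplex V}

theorem mem_geometricRealization_iff {p : V → ℝ} :
    p ∈ geometricRealization K ↔ p ∈ conicalRealization K ∧ ∑ v, p v = 1 := by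
  constructor
  · rintro ⟨hp, s, hs, hps, hsum⟩
    refine ⟨⟨hp, s, hs, hps⟩, ?_⟩
    rw [← hsum]
    exact (Finset.sum_subset (Finset.subset_univ s) fun v _ hv => hps v hv).symm
  · rintro ⟨⟨hp, s, hs, hps⟩, hsum⟩
    refine ⟨hp, s, hs, hps, ?_⟩
    rw [← hsum]
    exact Finset.sum_subset (Finset.subset_univ s) fun v _ hv => hps v hv

theorem isClosed_conicalRealization : IsClosed (conicalRealization K) := by
  have : conicalRealization K =
      ⋃ s ∈ K.faces, {p : V → ℝ | (∀ v, 0 ≤ p v) ∧ ∀ v ∉ s, p v = 0} := by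
    ext p
    simp only [conicalRealization, Set.mem_ofPred_eq, Set.mem_iUnion, exists_prop]
    tauto
  rw [this]
  refine (Set.toFinite K.faces).isClosed_biUnion fun s _ => ?_
  simp only [Set.ofPred_and, Set.ofPred_forall]
  refine (isClosed_iInter fun v => isClosed_le continuous_const (continuous_apply v)).inter
    (isClosed_iInter fun v => isClosed_iInter fun _ =>
      isClosed_eq (continuous_apply v) continuous_const)

theorem isCompact_geometricRealization : IsCompact (geometricRealization K) := by
  refine (isCompact_Icc (a := (0 : V → ℝ)) (b := 1)).of_isClosed_subset ?_ ?_
  · have : geometricRealization K = conicalRealization K ∩ {p | ∑ v, p v = 1} :=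
      Set.ext fun p => mem_geometricRealization_iff
    rw [this]
    exact isClosed_conicalRealization.inter (isClosed_eq (by fun_prop) continuous_const)
  · intro p hp
    obtain ⟨⟨hp, -⟩, hsum⟩ := mem_geometricRealization_iff.1 hp
    refine ⟨hp, fun v => ?_⟩
    rw [Pi.one_apply, ← hsum]
    exact Finset.single_le_sum (fun u _ => hp u) (Finset.mem_univ v)

end Realization

namespace IsCompleteSimplicialFan

section Radial

variable {V E : Type*} [Fintype V] [NormedAddCommGroup E] [NormedSpace ℝ E]
  {K : AbstractSimplicialComplex V} {w : V → E}

theorem linearCombination_ne_zero (h : IsCompleteSimplicialFan K w) {p : V → ℝ}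
    (hp : p ∈ geometricRealization K) : Fintype.linearCombination ℝ w p ≠ 0 := by
  obtain ⟨hp, hsum⟩ := mem_geometricRealization_iff.1 hp
  intro h0
  have h0' : (0 : V → ℝ) ∈ conicalRealization K := by
    simpa using smul_mem_conicalRealization hp le_rfl
  have := h.injOn hp h0' (by rw [h0, map_zero])
  simp [this] at hsum

theorem exists_smul_mem_geometricRealization (h : IsCompleteSimplicialFan K w) {x : E}
    (hx : x ≠ 0) : ∃ p ∈ geometricRealization K, ∃ c : ℝ, 0 < c ∧
      x = c • Fintype.linearCombination ℝ w p := by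
  obtain ⟨p, hp, rfl⟩ := h.surjOn (Set.mem_univ x)
  have hsum : 0 < ∑ v, p v := by
    refine lt_of_le_of_ne (Finset.sum_nonneg fun v _ => hp.1 v) fun h0 => hx ?_
    have : p = 0 := funext fun v =>
      (Finset.sum_eq_zero_iff_of_nonneg fun v _ => hp.1 v).1 h0.symm v (Finset.mem_univ v)
    rw [this, map_zero]
  refine ⟨(∑ v, p v)⁻¹ • p, mem_geometricRealization_iff.2
    ⟨smul_mem_conicalRealization hp (inv_nonneg.2 hsum.le), ?_⟩, _, hsum, ?_⟩
  · simp only [Pi.smul_apply, smul_eq_mul, ← Finset.mul_sum]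
    exact inv_mul_cancel₀ hsum.ne'
  · rw [map_smul, smul_inv_smul₀ hsum.ne']

/-- Radial projection from the origin identifies the geometric realization with the boundary of
any bounded convex neighbourhood of the origin. -/
theorem exists_homeomorph_frontier (h : IsCompleteSimplicialFan K w) {s : Set E}
    (hc : Convex ℝ s) (h0 : s ∈ 𝓝 0) (hb : Bornology.IsVonNBounded ℝ s) :
    ∃ φ : geometricRealization K ≃ₜ frontier s, ∀ p, ∃ c : ℝ, 0 < c ∧
      (φ p : E) = c • Fintype.linearCombination ℝ w p.1 := by
  set L := Fintype.linearCombination ℝ w with hL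
  have hpos : ∀ x : E, x ≠ 0 → 0 < gauge s x := fun x hx =>
    (gauge_pos (absorbent_nhds_zero h0) hb).2 hx
  have hpos' : ∀ p : geometricRealization K, 0 < gauge s (L p.1) := fun p =>
    hpos _ (h.linearCombination_ne_zero p.2)
  let f : geometricRealization K → frontier s := fun p =>
    ⟨(gauge s (L p.1))⁻¹ • L p.1, (gauge_eq_one_iff_mem_frontier hc h0).1 (by
      rw [gauge_smul_of_nonneg (inv_nonneg.2 (hpos' p).le), smul_eq_mul,
        inv_mul_cancel₀ (hpos' p).ne'])⟩
  have hLc : Continuous fun p : geometricRealization K => L p.1 := by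
    simp only [hL, Fintype.linearCombination_apply]
    exact continuous_finsetSum _ fun v _ =>
      ((continuous_apply v).comp continuous_subtype_val).smul continuous_const
  have hfc : Continuous f := Continuous.subtype_mk
    ((((continuous_gauge hc h0).comp hLc).inv₀ fun p => (hpos' p).ne').smul hLc) _
  have hinj : Function.Injective f := by
    intro p q hpq
    have hpq' : L ((gauge s (L p.1))⁻¹ • p.1) = L ((gauge s (L q.1))⁻¹ • q.1) := by
      rw [map_smul, map_smul]; exact Subtype.ext_iff.1 hpq
    obtain ⟨hp, hps⟩ := mem_geometricRealization_iff.1 p.2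
    obtain ⟨hq, hqs⟩ := mem_geometricRealization_iff.1 q.2
    have heq := h.injOn
      (smul_mem_conicalRealization hp (inv_nonneg.2 (hpos' p).le))
      (smul_mem_conicalRealization hq (inv_nonneg.2 (hpos' q).le)) hpq'
    have hsum := congrArg (fun r : V → ℝ => ∑ v, r v) heq
    simp only [Pi.smul_apply, smul_eq_mul, ← Finset.mul_sum, hps, hqs, mul_one] at hsum
    rw [hsum] at heq
    exact Subtype.ext (smul_right_injective _ (inv_ne_zero (hpos' q).ne') heq)
  have hsurj : Function.Surjective f := by
    rintro ⟨y, hy⟩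
    have hy1 := (gauge_eq_one_iff_mem_frontier hc h0).2 hy
    have hy0 : y ≠ 0 := by rintro rfl; simp at hy1
    obtain ⟨p, hp, c, hc0, rfl⟩ := h.exists_smul_mem_geometricRealization hy0
    rw [gauge_smul_of_nonneg hc0.le, smul_eq_mul] at hy1
    refine ⟨⟨p, hp⟩, Subtype.ext ?_⟩
    change (gauge s (L p))⁻¹ • L p = c • L p
    rw [eq_inv_of_mul_eq_one_left hy1]
  have : CompactSpace (geometricRealization K) :=
    isCompact_iff_compactSpace.1 isCompact_geometricRealization
  refine ⟨(isHomeomorph_iff_continuous_bijective.2 ⟨hfc, hinj, hsurj⟩).homeomorph, fun p => ?_⟩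
  exact ⟨_, inv_pos.2 (hpos' p), rfl⟩

theorem nonempty_homeomorph_sphere {d : ℕ} {w : V → Fin d → ℝ}
    (h : IsCompleteSimplicialFan K w) :
    Nonempty (geometricRealization K ≃ₜ Metric.sphere (0 : EuclideanSpace ℝ (Fin d)) 1) := by
  let e := (WithLp.linearEquiv 2 ℝ (Fin d → ℝ)).symm
  have he : IsCompleteSimplicialFan K (fun v => (e (w v) : EuclideanSpace ℝ (Fin d))) := by
    have hcomp := (e.bijective.bijOn_univ).comp h
    refine hcomp.congr fun p _ => ?_
    simp [Fintype.linearCombination_apply]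
  obtain ⟨φ, -⟩ := he.exists_homeomorph_frontier (convex_closedBall 0 1)
    (Metric.closedBall_mem_nhds 0 one_pos)
    (NormedSpace.isVonNBounded_closedBall ℝ _ 1)
  exact ⟨φ.trans (Homeomorph.setCongr (frontier_closedBall 0 one_ne_zero))⟩

/-- The origin is an interior point of the convex hull of the generators of a complete fan. -/
theorem convexHull_range_mem_nhds_zero [FiniteDimensional ℝ E] [Nontrivial E]
    (h : IsCompleteSimplicialFan K w) : convexHull ℝ (Set.range w) ∈ 𝓝 0 := by
  set D := convexHull ℝ (Set.range w)
  have hD : Convex ℝ D := convex_convexHull ..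
  have hw : ∀ v, w v ∈ D := fun v => subset_convexHull _ _ ⟨v, rfl⟩
  have habs : ∀ x : E, x ≠ 0 → ∃ c : ℝ, 0 < c ∧ c • x ∈ D := by
    intro x hx
    obtain ⟨p, hp, c, hc, rfl⟩ := h.exists_smul_mem_geometricRealization hx
    obtain ⟨hp, hsum⟩ := mem_geometricRealization_iff.1 hp
    refine ⟨c⁻¹, inv_pos.2 hc, ?_⟩
    rw [inv_smul_smul₀ hc.ne', Fintype.linearCombination_apply]
    exact hD.sum_mem (fun v _ => hp.1 v) hsum fun v _ => hw v
  have h0 : (0 : E) ∈ D := by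
    obtain ⟨x, hx⟩ := exists_ne (0 : E)
    obtain ⟨a, ha, hax⟩ := habs x hx
    obtain ⟨b, hb, hbx⟩ := habs (-x) (neg_ne_zero.2 hx)
    -- the origin lies on the segment from `a • x` to `-b • x`
    have := hD hax hbx (a := b / (a + b)) (b := a / (a + b)) (by positivity) (by positivity)
      (by field_simp; ring)
    convert this using 1
    simp only [smul_smul, smul_neg, ← sub_eq_add_neg, ← sub_smul]
    rw [show b / (a + b) * a - a / (a + b) * b = 0 by ring, zero_smul]
  obtain ⟨z, hz⟩ : (interior D).Nonempty := by
    rw [interior_convexHull_nonempty_iff_affineSpan_eq_top, eq_top_iff]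
    intro x _
    have hsub : D ⊆ affineSpan ℝ (Set.range w) := convexHull_subset_affineSpan _
    by_cases hx : x = 0
    · rw [hx]; exact hsub h0
    obtain ⟨c, hc, hcx⟩ := habs x hx
    have := AffineMap.lineMap_mem c⁻¹ (hsub h0) (hsub hcx)
    simpa [AffineMap.lineMap_apply, smul_smul, hc.ne'] using this
  rw [mem_nhds_iff]
  refine ⟨interior D, interior_subset, isOpen_interior, ?_⟩
  by_cases hz0 : z = 0
  · rwa [hz0] at hz
  obtain ⟨c, hc, hcz⟩ := habs (-z) (neg_ne_zero.2 hz0)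
  refine hD.openSegment_interior_self_subset_interior hz hcz
    ⟨c / (1 + c), 1 / (1 + c), by positivity, by positivity, by field_simp; ring, ?_⟩
  simp only [smul_smul, smul_neg, ← sub_eq_add_neg, ← sub_smul]
  rw [show c / (1 + c) - 1 / (1 + c) * c = 0 by ring, zero_smul]

end Radial

end IsCompleteSimplicialFan

/-! ### Facets of a complete simplicial fan -/

theorem dense_iInter_compl_submodule {ι E : Type*} [Finite ι] [NormedAddCommGroup E]
    [NormedSpace ℝ E] [FiniteDimensional ℝ E] (S : ι → Submodule ℝ E) (hS : ∀ i, S i ≠ ⊤) :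
    Dense (⋂ i, (S i : Set E)ᶜ) := by
  have : CompleteSpace E := FiniteDimensional.complete ℝ E
  refine dense_iInter_of_isOpen (fun i => (S i).closed_of_finiteDimensional.isOpen_compl)
    fun i => ?_
  rw [← interior_eq_empty_iff_dense_compl]
  by_contra hne
  exact hS i ((S i).eq_top_of_nonempty_interior' (Set.nonempty_iff_ne_empty.2 hne))

theorem span_ne_top_of_card_le {n : ℕ} {t : Finset (Fin (n + 1) → ℝ)} (ht : t.card ≤ n) :
    Submodule.span ℝ (t : Set (Fin (n + 1) → ℝ)) ≠ ⊤ := by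
  intro h
  have h1 := finrank_span_finset_le_card (R := ℝ) t
  rw [Set.finrank, h, finrank_top, Module.finrank_fin_fun] at h1
  omega

namespace IsCompleteSimplicialFan

section Facets

variable {V : Type*} [Fintype V] {K : AbstractSimplicialComplex V} {n : ℕ}
  {w : V → Fin (n + 1) → ℝ}

/-- The cone spanned by the generators in a finite set. -/
def faceCone (w : V → Fin (n + 1) → ℝ) (s : Finset V) : Set (Fin (n + 1) → ℝ) :=
  {x | ∃ p : V → ℝ, (∀ v, 0 ≤ p v) ∧ (∀ v ∉ s, p v = 0) ∧ Fintype.linearCombination ℝ w p = x}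

/-- Uniqueness of nonnegative representations gives linear independence: compare the positive and
the negative part of a relation. -/
theorem eq_zero_of_linearCombination_eq_zero (h : IsCompleteSimplicialFan K w) {s : Finset V}
    (hs : s ∈ K.faces) {f : V → ℝ} (hf : ∀ v ∉ s, f v = 0)
    (h0 : Fintype.linearCombination ℝ w f = 0) : f = 0 := by
  have hfpq : f = (fun v => max (f v) 0) - fun v => max (-f v) 0 := by
    funext v
    rcases le_total (f v) 0 with hv | hv <;> simp [hv]
  have : (fun v => max (f v) 0) = fun v => max (-f v) 0 := h.injOn
    ⟨fun v => le_max_right _ _, s, hs, fun v hv => by simp [hf v hv]⟩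
    ⟨fun v => le_max_right _ _, s, hs, fun v hv => by simp [hf v hv]⟩
    (by rw [← sub_eq_zero, ← map_sub, ← hfpq, h0])
  rw [hfpq, this, sub_self]

theorem linearCombination_extend [DecidableEq V] (s : Finset V) (g : s → ℝ) :
    Fintype.linearCombination ℝ w (fun v => if hv : v ∈ s then g ⟨v, hv⟩ else 0) =
      Fintype.linearCombination ℝ (fun v : s => w v) g := by
  rw [Fintype.linearCombination_apply, Fintype.linearCombination_apply]
  rw [← Finset.sum_subset (Finset.subset_univ s) fun v _ hv => by rw [dif_neg hv, zero_smul],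
    ← Finset.sum_coe_sort s]
  exact Finset.sum_congr rfl fun v _ => by simp

theorem linearIndependent_face (h : IsCompleteSimplicialFan K w) {s : Finset V}
    (hs : s ∈ K.faces) : LinearIndependent ℝ (fun v : s => w v) := by
  classical
  rw [Fintype.linearIndependent_iff]
  intro g hg v
  have := h.eq_zero_of_linearCombination_eq_zero hs
    (f := fun v => if hv : v ∈ s then g ⟨v, hv⟩ else 0) (fun v hv => dif_neg hv)
    (by rw [linearCombination_extend, Fintype.linearCombination_apply, hg])
  simpa using congrFun this v

theorem card_le (h : IsCompleteSimplicialFan K w) {s : Finset V} (hs : s ∈ K.faces) :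
    s.card ≤ n + 1 := by
  simpa using (h.linearIndependent_face hs).fintype_card_le_finrank

theorem isClosed_faceCone (h : IsCompleteSimplicialFan K w) {s : Finset V} (hs : s ∈ K.faces) :
    IsClosed (faceCone w s) := by
  classical
  have himg : faceCone w s =
      Fintype.linearCombination ℝ (fun v : s => w v) '' {g | ∀ v, 0 ≤ g v} := by
    ext x
    constructor
    · rintro ⟨p, hp, hps, rfl⟩
      refine ⟨fun v => p v, fun v => hp v, ?_⟩
      rw [← linearCombination_extend]
      congr 1
      funext v
      split_ifs with hv
      · rfl
      · exact (hps v hv).symm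
    · rintro ⟨g, hg, rfl⟩
      refine ⟨_, fun v => ?_, fun v hv => ?_, linearCombination_extend s g⟩
      · split_ifs with hv
        · exact hg _
        · exact le_rfl
      · exact dif_neg hv
  rw [himg]
  have hcl := LinearMap.isClosedEmbedding_of_injective
    (f := Fintype.linearCombination ℝ (fun v : s => w v))
    (LinearMap.ker_eq_bot.2 (h.linearIndependent_face hs).fintypeLinearCombination_injective)
  refine hcl.isClosedMap _ ?_
  simp only [Set.ofPred_forall]
  exact isClosed_iInter fun v => isClosed_le continuous_const (continuous_apply v)

theorem linearCombination_mem_span {s : Finset V} {p : V → ℝ} (hp : ∀ v ∉ s, p v = 0) :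
    Fintype.linearCombination ℝ w p ∈ Submodule.span ℝ (w '' s) := by
  rw [Fintype.linearCombination_apply]
  refine Submodule.sum_mem _ fun v _ => ?_
  by_cases hv : v ∈ s
  · exact Submodule.smul_mem _ _ (Submodule.subset_span ⟨v, hv, rfl⟩)
  · rw [hp v hv, zero_smul]
    exact Submodule.zero_mem _

/-- The full-dimensional cones cover the whole space, since they form a closed set and the
remaining cones are contained in finitely many proper subspaces. -/
theorem exists_facet (h : IsCompleteSimplicialFan K w) (x : Fin (n + 1) → ℝ) :
    ∃ s ∈ K.faces, s.card = n + 1 ∧ x ∈ faceCone w s := by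
  classical
  set C : Set (Fin (n + 1) → ℝ) := ⋃ s ∈ {s | s ∈ K.faces ∧ s.card = n + 1}, faceCone w s
  have hC : IsClosed C :=
    (Set.toFinite _).isClosed_biUnion fun s hs => h.isClosed_faceCone hs.1
  have hdense := dense_iInter_compl_submodule
    (fun s : {s : Finset V // s.card ≤ n} => Submodule.span ℝ (w '' s.1)) fun s => by
      have := span_ne_top_of_card_le (t := s.1.image w) (Finset.card_image_le.trans s.2)
      rwa [Finset.coe_image] at this
  have hsub : (⋂ s : {s : Finset V // s.card ≤ n},
      (Submodule.span ℝ (w '' s.1) : Set (Fin (n + 1) → ℝ))ᶜ) ⊆ C := by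
    intro y hy
    obtain ⟨p, ⟨hp, s, hs, hps⟩, rfl⟩ := h.surjOn (Set.mem_univ y)
    refine Set.mem_biUnion (x := s) ⟨hs, le_antisymm (h.card_le hs) ?_⟩ ⟨p, hp, hps, rfl⟩
    by_contra hlt
    exact Set.mem_iInter.1 hy ⟨s, by omega⟩ (linearCombination_mem_span hps)
  have hx : x ∈ C := by
    have := (hdense.mono hsub).closure_eq
    rw [hC.closure_eq] at this
    rw [this]; trivial
  obtain ⟨s, ⟨hs, hsc⟩, hxs⟩ := Set.mem_iUnion₂.1 hx
  exact ⟨s, hs, hsc, hxs⟩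

theorem exists_linearCombination_eq_of_facet (h : IsCompleteSimplicialFan K w)
    {s : Finset V} (hs : s ∈ K.faces) (hsc : s.card = n + 1) (x : Fin (n + 1) → ℝ) :
    ∃ f : V → ℝ, (∀ v ∉ s, f v = 0) ∧ Fintype.linearCombination ℝ w f = x := by
  classical
  have hsurj : Function.Surjective (Fintype.linearCombination ℝ (fun v : s => w v)) := by
    rw [← LinearMap.injective_iff_surjective_of_finrank_eq_finrank (by simp [hsc])]
    exact (h.linearIndependent_face hs).fintypeLinearCombination_injective
  obtain ⟨g, rfl⟩ := hsurj x
  exact ⟨_, fun v hv => dif_neg hv, linearCombination_extend s g⟩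

/-- The interior of a full-dimensional cone contains a vector outside any finite family of proper
subspaces. -/
theorem exists_mem_faceCone_notMem (h : IsCompleteSimplicialFan K w) {s : Finset V}
    (hs : s ∈ K.faces) (hsc : s.card = n + 1) {ι : Type*} [Finite ι]
    (S : ι → Submodule ℝ (Fin (n + 1) → ℝ)) (hS : ∀ i, S i ≠ ⊤) :
    ∃ y ∈ faceCone w s, ∀ i, y ∉ S i := by
  classical
  set L := Fintype.linearCombination ℝ (fun v : s => w v) with hL
  have hsurj : Function.Surjective L := by
    rw [← LinearMap.injective_iff_surjective_of_finrank_eq_finrank (by simp [hsc])]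
    exact (h.linearIndependent_face hs).fintypeLinearCombination_injective
  have hpos : IsOpen {g : s → ℝ | ∀ v, 0 < g v} := by
    simp only [Set.ofPred_forall]
    exact isOpen_iInter_of_finite fun v => isOpen_lt continuous_const (continuous_apply v)
  have hopen : IsOpen (L '' {g : s → ℝ | ∀ v, 0 < g v}) :=
    L.isOpenMap_of_finiteDimensional hsurj _ hpos
  obtain ⟨_, ⟨g, hg, rfl⟩, hyS⟩ := (dense_iInter_compl_submodule S hS).inter_open_nonempty _ hopen
    ⟨_, ⟨1, fun _ => one_pos, rfl⟩⟩
  refine ⟨L g, ⟨_, fun v => ?_, fun v hv => ?_, linearCombination_extend s g⟩,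
    fun i hi => Set.mem_iInter.1 hyS i hi⟩
  · split_ifs with hv
    · exact (hg _).le
    · exact le_rfl
  · exact dif_neg hv

end Facets

/-! ### Ridges and their two facets -/

section Determinants

variable {V : Type*} [LinearOrder V] {n : ℕ} {w : V → Fin (n + 1) → ℝ}

/-- The determinant of the generators in a set of `n + 1` vertices, in increasing order. -/
noncomputable def facetDet (w : V → Fin (n + 1) → ℝ) (s : Finset V) (hs : s.card = n + 1) : ℝ :=
  (Matrix.of fun i => w (s.orderEmbOfFin hs i)).det

/-- The linear functional `x ↦ det (x, τ)` vanishing on the hyperplane through a set `τ` of `n`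
generators in increasing order, written as the Laplace expansion along the row `x`. -/
noncomputable def ridgeFunctional (w : V → Fin (n + 1) → ℝ) (τ : Finset V) (hτ : τ.card = n) :
    (Fin (n + 1) → ℝ) →ₗ[ℝ] ℝ :=
  Fintype.linearCombination ℝ fun j : Fin (n + 1) => (-1 : ℝ) ^ (j : ℕ) *
    ((Matrix.of fun i => w (τ.orderEmbOfFin hτ i)).submatrix id j.succAbove).det

theorem ridgeFunctional_eq_det (τ : Finset V) (hτ : τ.card = n) (x : Fin (n + 1) → ℝ) :
    ridgeFunctional w τ hτ x =
      (Matrix.of (Fin.cons x fun i => w (τ.orderEmbOfFin hτ i) :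
        Fin (n + 1) → Fin (n + 1) → ℝ)).det := by
  rw [Matrix.det_succ_row_zero, ridgeFunctional, Fintype.linearCombination_apply]
  refine Finset.sum_congr rfl fun j _ => ?_
  have : (Matrix.of (Fin.cons x fun i => w (τ.orderEmbOfFin hτ i) :
        Fin (n + 1) → Fin (n + 1) → ℝ)).submatrix Fin.succ j.succAbove =
      (Matrix.of fun i => w (τ.orderEmbOfFin hτ i)).submatrix id j.succAbove := by
    ext a b; simp
  rw [this]
  simp only [Matrix.of_apply, Fin.cons_zero, smul_eq_mul]
  ring

theorem ridgeFunctional_eq_zero {τ : Finset V} (hτ : τ.card = n) {v : V} (hv : v ∈ τ) :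
    ridgeFunctional w τ hτ (w v) = 0 := by
  rw [ridgeFunctional_eq_det]
  obtain ⟨i, rfl⟩ : ∃ i, τ.orderEmbOfFin hτ i = v := by
    have := Finset.range_orderEmbOfFin τ hτ
    exact (Set.ext_iff.1 this v).2 hv
  exact Matrix.det_zero_of_row_eq (i := 0) (j := i.succ) (Fin.succ_ne_zero i).symm
    (by ext; simp [Matrix.of_apply])

/-- Laplace expansion of the determinant of a facet along the row of one of its vertices. -/
theorem facetDet_insert {τ : Finset V} (hτ : τ.card = n) {a : V}
    (hs : (insert a τ).card = n + 1) :
    facetDet w (insert a τ) hs =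
      (-1) ^ ((insert a τ).filter (· < a)).card * ridgeFunctional w τ hτ (w a) := by
  obtain ⟨i, hi⟩ : ∃ i, (insert a τ).orderEmbOfFin hs i = a := by
    have := Finset.range_orderEmbOfFin (insert a τ) hs
    exact (Set.ext_iff.1 this a).2 (Finset.mem_insert_self a τ)
  have hcard : ((insert a τ).filter (· < a)).card = (i : ℕ) := by
    have : (insert a τ).filter (· < a) =
        (Finset.Iio i).map ((insert a τ).orderEmbOfFin hs).toEmbedding := by
      ext v
      simp only [Finset.mem_filter, Finset.mem_map, Finset.mem_Iio]
      constructor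
      · rintro ⟨hv, hva⟩
        obtain ⟨j, rfl⟩ : ∃ j, (insert a τ).orderEmbOfFin hs j = v :=
          (Set.ext_iff.1 (Finset.range_orderEmbOfFin (insert a τ) hs) v).2 hv
        refine ⟨j, ?_, rfl⟩
        exact ((insert a τ).orderEmbOfFin hs).lt_iff_lt.1 (hva.trans_eq hi.symm)
      · rintro ⟨j, hj, rfl⟩
        refine ⟨Finset.orderEmbOfFin_mem _ _ _, ?_⟩
        exact (((insert a τ).orderEmbOfFin hs).lt_iff_lt.2 hj).trans_eq hi
    rw [this, Finset.card_map, Fin.card_Iio]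
  have hsub : (fun k => (insert a τ).orderEmbOfFin hs (i.succAbove k)) =
      τ.orderEmbOfFin hτ := by
    refine Finset.orderEmbOfFin_unique hτ (fun k => ?_) ?_
    · have h1 := Finset.orderEmbOfFin_mem (insert a τ) hs (i.succAbove k)
      refine (Finset.mem_insert.1 h1).resolve_left fun h2 => ?_
      exact Fin.succAbove_ne i k (((insert a τ).orderEmbOfFin hs).injective (h2.trans hi.symm))
    · exact ((insert a τ).orderEmbOfFin hs).strictMono.comp (Fin.strictMono_succAbove i)
  rw [facetDet, Matrix.det_succ_row _ i, hcard, ridgeFunctional,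
    Fintype.linearCombination_apply, Finset.mul_sum]
  refine Finset.sum_congr rfl fun j _ => ?_
  have : (Matrix.of fun i => w ((insert a τ).orderEmbOfFin hs i)).submatrix
      i.succAbove j.succAbove =
      (Matrix.of fun i => w (τ.orderEmbOfFin hτ i)).submatrix id j.succAbove := by
    ext k l
    simp only [Matrix.submatrix_apply, Matrix.of_apply, id, ← hsub]
  rw [this, pow_add]
  simp only [Matrix.of_apply, hi, smul_eq_mul]
  ring

end Determinants

section Ridges

variable {V : Type*} [Fintype V] [LinearOrder V] {K : AbstractSimplicialComplex V} {n : ℕ}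
  {w : V → Fin (n + 1) → ℝ}

theorem ridgeFunctional_linearCombination {τ : Finset V} (hτ : τ.card = n) {a : V}
    {f : V → ℝ} (hf : ∀ v ∉ insert a τ, f v = 0) :
    ridgeFunctional w τ hτ (Fintype.linearCombination ℝ w f) =
      f a * ridgeFunctional w τ hτ (w a) := by
  rw [Fintype.linearCombination_apply, map_sum, Finset.sum_eq_single a]
  · rw [map_smul, smul_eq_mul]
  · intro v _ hva
    rw [map_smul]
    by_cases hv : v ∈ τ
    · rw [ridgeFunctional_eq_zero hτ hv, smul_zero]
    · rw [hf v (by simp [hv, hva]), zero_smul]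
  · simp

theorem facetDet_ne_zero (h : IsCompleteSimplicialFan K w) {s : Finset V} (hs : s ∈ K.faces)
    (hsc : s.card = n + 1) : facetDet w s hsc ≠ 0 := by
  have hli : LinearIndependent ℝ fun i => w (s.orderEmbOfFin hsc i) :=
    (h.linearIndependent_face hs).comp
      (fun i => (⟨s.orderEmbOfFin hsc i, Finset.orderEmbOfFin_mem _ _ _⟩ : s))
      fun i j hij => (s.orderEmbOfFin hsc).injective (Subtype.ext_iff.1 hij)
  have := Matrix.linearIndependent_rows_iff_isUnit
    (A := Matrix.of fun i => w (s.orderEmbOfFin hsc i)).1 hli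
  exact ((Matrix.isUnit_iff_isUnit_det _).1 this).ne_zero

theorem ridgeFunctional_ne_zero (h : IsCompleteSimplicialFan K w) {τ : Finset V}
    (hτ : τ.card = n) {a : V} (ha : a ∉ τ) (haτ : insert a τ ∈ K.faces) :
    ridgeFunctional w τ hτ (w a) ≠ 0 := by
  have hs : (insert a τ).card = n + 1 := by rw [Finset.card_insert_of_notMem ha, hτ]
  have := h.facetDet_ne_zero haτ hs
  rw [facetDet_insert hτ hs] at this
  exact right_ne_zero_of_mul this

/-- On each side of a ridge lies at most one facet: two facets on the same side would have
overlapping interiors. -/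
theorem eq_of_ridgeFunctional_mul_pos (h : IsCompleteSimplicialFan K w) {τ : Finset V}
    (hτ : τ.card = n) {a b : V} (ha : a ∉ τ) (haτ : insert a τ ∈ K.faces)
    (hbτ : insert b τ ∈ K.faces)
    (hab : 0 < ridgeFunctional w τ hτ (w a) * ridgeFunctional w τ hτ (w b)) : a = b := by
  have hs : (insert a τ).card = n + 1 := by rw [Finset.card_insert_of_notMem ha, hτ]
  obtain ⟨f, hf, hfb⟩ := h.exists_linearCombination_eq_of_facet haτ hs (w b)
  have hfa : 0 < f a := by
    rw [← hfb, ridgeFunctional_linearCombination hτ hf] at hab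
    have h1 : 0 < f a * (ridgeFunctional w τ hτ (w a)) ^ 2 := by linarith
    exact pos_of_mul_pos_left h1 (sq_nonneg _)
  by_contra hne
  -- move the negative coefficients of `w b` over the basis `insert a τ` to the other side
  have hpq : (fun v => max (f v) 0) = Pi.single b 1 + fun v => max (-f v) 0 := by
    refine h.injOn ⟨fun v => le_max_right _ _, _, haτ, fun v hv => by simp [hf v hv]⟩
      ⟨fun v => add_nonneg ?_ (le_max_right _ _), _, hbτ, fun v hv => ?_⟩ ?_
    · by_cases hv : v = b
      · subst hv; simp
      · simp [hv]
    · have hvb : v ≠ b := fun hvb => hv (by simp [hvb])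
      have hvτ : v ∉ τ := fun hvτ => hv (by simp [hvτ])
      by_cases hva : v = a
      · subst hva; simp [hvb, hfa.le]
      · simp [hvb, hf v (by simp [hva, hvτ])]
    · rw [map_add, Fintype.linearCombination_apply_single, one_smul, ← hfb, ← sub_eq_iff_eq_add,
        ← map_sub]
      congr 1
      funext v
      rcases le_total (f v) 0 with hv | hv <;> simp [hv]
  have := congrFun hpq a
  simp [hne, hfa.le, hfa.ne'] at this

/-- Each facet at a ridge has a neighbour on the other side of the ridge: the facets that do not
contain the ridge stay away from its interior points. -/
theorem exists_opposite (h : IsCompleteSimplicialFan K w) {τ : Finset V}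
    (hτ : τ.card = n) {a : V} (ha : a ∉ τ) (haτ : insert a τ ∈ K.faces) :
    ∃ b ∉ τ, insert b τ ∈ K.faces ∧
      ridgeFunctional w τ hτ (w a) * ridgeFunctional w τ hτ (w b) < 0 := by
  set L := Fintype.linearCombination ℝ w with hL
  set φ := ridgeFunctional w τ hτ
  set p : V → ℝ := fun v => if v ∈ τ then 1 else 0 with hp
  have hpK : p ∈ conicalRealization K :=
    ⟨fun v => by simp only [hp]; split_ifs <;> simp, _, haτ,
      fun v hv => if_neg fun hvτ => hv (Finset.mem_insert_of_mem hvτ)⟩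
  set C : Set (Fin (n + 1) → ℝ) :=
    ⋃ s ∈ {s | s ∈ K.faces ∧ ¬ τ ⊆ s}, faceCone w s
  have hC : IsClosed C :=
    (Set.toFinite _).isClosed_biUnion fun s hs => h.isClosed_faceCone hs.1
  have hpC : L p ∉ C := by
    intro hmem
    obtain ⟨s, ⟨hs, hτs⟩, q, hq, hqs, hqp⟩ := Set.mem_iUnion₂.1 hmem
    have : q = p := h.injOn ⟨hq, s, hs, hqs⟩ hpK hqp
    refine hτs fun v hv => by_contra fun hvs => ?_
    have h1 := hqs v hvs
    rw [this] at h1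
    simp [hp, hv] at h1
  obtain ⟨ε, hε, hεC⟩ : ∃ ε : ℝ, 0 < ε ∧ L p - ε • w a ∉ C := by
    have hcont : Continuous fun ε : ℝ => L p - ε • w a := by fun_prop
    have hnhds : (fun ε : ℝ => L p - ε • w a) ⁻¹' Cᶜ ∈ 𝓝 (0 : ℝ) :=
      (hC.isOpen_compl.preimage hcont).mem_nhds (by simpa using hpC)
    obtain ⟨δ, hδ, hball⟩ := Metric.mem_nhds_iff.1 hnhds
    exact ⟨δ / 2, by positivity, hball (by
      rw [Metric.mem_ball, Real.dist_eq, sub_zero, abs_of_pos (by positivity)]; linarith)⟩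
  obtain ⟨s, hs, hsc, q, hq, hqs, hqx⟩ := h.exists_facet (L p - ε • w a)
  have hτs : τ ⊆ s := by
    by_contra hcon
    exact hεC (Set.mem_biUnion (x := s) ⟨hs, hcon⟩ ⟨q, hq, hqs, hqx⟩)
  obtain ⟨b, hb, rfl⟩ : ∃ b ∉ τ, insert b τ = s :=
    (Finset.covBy_iff_exists_insert.1 (Finset.covBy_iff_card_sdiff_eq_one.2 ⟨hτs, by
      rw [Finset.card_sdiff_of_subset hτs]; omega⟩))
  refine ⟨b, hb, hs, ?_⟩
  have h1 : φ (L p) = 0 := by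
    rw [ridgeFunctional_linearCombination hτ (a := a)
      fun v hv => if_neg fun hvτ => hv (Finset.mem_insert_of_mem hvτ)]
    simp [ha]
  have h2 := congrArg φ hqx
  rw [ridgeFunctional_linearCombination hτ hqs, map_sub, h1, map_smul, zero_sub,
    smul_eq_mul] at h2
  have h3 : 0 < φ (w a) ^ 2 := sq_pos_of_ne_zero (h.ridgeFunctional_ne_zero hτ ha haτ)
  have h4 : q b * (φ (w a) * φ (w b)) = -(ε * φ (w a) ^ 2) := by
    linear_combination φ (w a) * h2
  by_contra hcon
  have h5 := mul_nonneg (hq b) (not_lt.1 hcon)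
  have h6 := mul_pos hε h3
  linarith

end Ridges

end IsCompleteSimplicialFan

/-! ### Top homology -/

namespace SimplicialHomology

theorem eq_zero_of_mem_chains {V : Type*} {K : AbstractSimplicialComplex V} {n : ℕ}
    {c : Finset V →₀ ℚ} (hc : c ∈ chains K n) {s : Finset V}
    (hs : ¬ (s ∈ K.faces ∧ s.card = n + 1)) : c s = 0 := by
  by_contra h
  exact hs ((Finsupp.mem_supported ℚ c).1 hc (Finsupp.mem_support_iff.2 h))

variable {V : Type*} [Fintype V] [LinearOrder V] {K : AbstractSimplicialComplex V} {n : ℕ}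

/-- The coefficient of a simplex in the boundary of a chain is the signed sum of the coefficients
of its cofaces. -/
theorem boundary_apply (hn : 1 ≤ n) {c : Finset V →₀ ℚ} (hc : c ∈ chains K n) (τ : Finset V) :
    boundary c τ = ∑ v ∈ Finset.univ.filter (· ∉ τ),
      c (insert v τ) * (-1) ^ ((insert v τ).filter (· < v)).card := by
  have h1 : boundary c τ = ∑ s : Finset V, ∑ v : V,
      if v ∈ s ∧ s.erase v = τ then c s * (-1) ^ (s.filter (· < v)).card else 0 := by
    rw [boundary, Finsupp.linearCombination_apply, Finsupp.sum_fintype _ _ (by simp),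
      Finsupp.finsetSum_apply]
    refine Finset.sum_congr rfl fun s _ => ?_
    rw [Finsupp.smul_apply, smul_eq_mul]
    by_cases hs : s ∈ K.faces ∧ s.card = n + 1
    · rw [boundaryOfSimplex, if_neg (by omega), Finsupp.finsetSum_apply, Finset.mul_sum,
        ← Finset.sum_filter_of_ne (s := Finset.univ) (p := (· ∈ s))
          (fun v _ hv => by by_contra hvs; simp [hvs] at hv),
        Finset.filter_univ_mem]
      refine Finset.sum_congr rfl fun v hv => ?_
      rw [Finsupp.single_apply]
      simp [hv]
    · simp [eq_zero_of_mem_chains hc hs]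
  rw [h1, Finset.sum_comm, Finset.sum_filter]
  refine Finset.sum_congr rfl fun v _ => ?_
  split_ifs with hv
  · refine Finset.sum_eq_zero fun s _ => if_neg ?_
    rintro ⟨-, rfl⟩
    exact Finset.notMem_erase v s hv
  · rw [Finset.sum_eq_single (insert v τ)]
    · rw [if_pos ⟨Finset.mem_insert_self v τ, Finset.erase_insert hv⟩]
    · rintro s - hs
      refine if_neg ?_
      rintro ⟨hvs, rfl⟩
      exact hs (Finset.insert_erase hvs).symm
    · simp

end SimplicialHomology

namespace IsCompleteSimplicialFan

open SimplicialHomology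

section FacetSign

variable {V : Type*} [LinearOrder V] {K : AbstractSimplicialComplex V} {n : ℕ}
  {w : V → Fin (n + 1) → ℝ}

open Classical in
/-- The sign of the basis of `ℝ^(n+1)` given by a facet with its vertices in increasing order, and
`0` for other sets of vertices. -/
noncomputable def facetSign (K : AbstractSimplicialComplex V) (w : V → Fin (n + 1) → ℝ)
    (s : Finset V) : ℚ :=
  if hs : s ∈ K.faces ∧ s.card = n + 1 then (SignType.sign (facetDet w s hs.2) : ℚ) else 0

theorem facetSign_insert {τ : Finset V} (hτ : τ.card = n) {a : V}
    (ha : a ∉ τ) (haτ : insert a τ ∈ K.faces) :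
    facetSign K w (insert a τ) * (-1) ^ ((insert a τ).filter (· < a)).card =
      (SignType.sign (ridgeFunctional w τ hτ (w a)) : ℚ) := by
  have hs : (insert a τ).card = n + 1 := by rw [Finset.card_insert_of_notMem ha, hτ]
  rw [facetSign, dif_pos ⟨haτ, hs⟩, facetDet_insert hτ hs]
  rcases neg_one_pow_eq_or ℚ ((insert a τ).filter (· < a)).card with he | he <;>
    rcases neg_one_pow_eq_or ℝ ((insert a τ).filter (· < a)).card with he' | he'
  · simp [he, he']
  · exfalso
    have : ((-1 : ℚ) ^ ((insert a τ).filter (· < a)).card : ℚ) = -1 := by exact_mod_cast he'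
    rw [he] at this; norm_num at this
  · exfalso
    have : ((-1 : ℚ) ^ ((insert a τ).filter (· < a)).card : ℚ) = 1 := by exact_mod_cast he'
    rw [he] at this; norm_num at this
  · simp [he, he', Left.sign_neg]

end FacetSign

variable {V : Type*} [Fintype V] [LinearOrder V] {K : AbstractSimplicialComplex V} {n : ℕ}
  {w : V → Fin (n + 1) → ℝ}

theorem facetSign_mul_self (h : IsCompleteSimplicialFan K w) {s : Finset V}
    (hs : s ∈ K.faces) (hsc : s.card = n + 1) : facetSign K w s * facetSign K w s = 1 := by
  rw [facetSign, dif_pos ⟨hs, hsc⟩]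
  rcases (h.facetDet_ne_zero hs hsc).lt_or_gt with hd | hd
  · simp [sign_neg hd]
  · simp [sign_pos hd]

/-- A ridge lies in exactly two facets, on opposite sides. In terms of the coefficients relative to
the orientations of the facets by the determinant, the boundary of a chain has as its coefficient
at the ridge the difference of the coefficients of the two facets, up to sign. -/
theorem exists_boundary_apply_eq (h : IsCompleteSimplicialFan K w) (hn : 1 ≤ n) {τ : Finset V}
    (hτ : τ.card = n) {a : V} (ha : a ∉ τ) (haτ : insert a τ ∈ K.faces) :
    ∃ b, (∀ v ∉ τ, insert v τ ∈ K.faces → v = a ∨ v = b) ∧ ∃ ε : ℚ, ε ≠ 0 ∧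
      (b ∉ τ ∧ insert b τ ∈ K.faces) ∧ ∀ c ∈ chains K n, boundary c τ =
        (c (insert a τ) * facetSign K w (insert a τ) -
          c (insert b τ) * facetSign K w (insert b τ)) * ε := by
  obtain ⟨b, hb, hbτ, hab⟩ := h.exists_opposite hτ ha haτ
  set φ := ridgeFunctional w τ hτ
  have honly : ∀ v ∉ τ, insert v τ ∈ K.faces → v = a ∨ v = b := by
    intro v hv hvτ
    have hv0 := h.ridgeFunctional_ne_zero hτ hv hvτ
    rcases mul_neg_iff.1 hab with ⟨h1, h2⟩ | ⟨h1, h2⟩ <;> rcases hv0.lt_or_gt with h3 | h3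
    · exact Or.inr (h.eq_of_ridgeFunctional_mul_pos hτ hv hvτ hbτ (mul_pos_of_neg_of_neg h3 h2))
    · exact Or.inl (h.eq_of_ridgeFunctional_mul_pos hτ hv hvτ haτ (mul_pos h3 h1))
    · exact Or.inl (h.eq_of_ridgeFunctional_mul_pos hτ hv hvτ haτ (mul_pos_of_neg_of_neg h3 h1))
    · exact Or.inr (h.eq_of_ridgeFunctional_mul_pos hτ hv hvτ hbτ (mul_pos h3 h2))
  have hne : a ≠ b := by
    rintro rfl
    exact absurd hab (not_lt.2 (mul_self_nonneg _))
  have hsign : (SignType.sign (φ (w b)) : ℚ) = -(SignType.sign (φ (w a)) : ℚ) ∧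
      (SignType.sign (φ (w a)) : ℚ) ≠ 0 := by
    rcases mul_neg_iff.1 hab with ⟨h1, h2⟩ | ⟨h1, h2⟩ <;> simp [sign_pos, sign_neg, h1, h2]
  refine ⟨b, honly, _, hsign.2, ⟨hb, hbτ⟩, fun c hc => ?_⟩
  have hterm : ∀ v ∉ τ, insert v τ ∈ K.faces →
      c (insert v τ) * (-1) ^ ((insert v τ).filter (· < v)).card =
        c (insert v τ) * facetSign K w (insert v τ) * (SignType.sign (φ (w v)) : ℚ) := by
    intro v hv hvτ
    have hs : (insert v τ).card = n + 1 := by rw [Finset.card_insert_of_notMem hv, hτ]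
    rw [← facetSign_insert hτ hv hvτ, mul_assoc, ← mul_assoc (facetSign K w _),
      h.facetSign_mul_self hvτ hs, one_mul]
  rw [boundary_apply hn hc, ← Finset.sum_subset (s₁ := {a, b})]
  · rw [Finset.sum_pair hne, hterm a ha haτ, hterm b hb hbτ, hsign.1]
    ring
  · intro v hv
    rcases Finset.mem_insert.1 hv with rfl | hv
    · simpa using ha
    · rw [Finset.mem_singleton.1 hv]; simpa using hb
  · intro v hv hvab
    rw [eq_zero_of_mem_chains hc, zero_mul]
    rintro ⟨hvτ, -⟩
    have := honly v (by simpa using hv) hvτ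
    simp at hvab
    tauto

/-- The fundamental chain: the sum of all facets, oriented by the determinant. -/
noncomputable def fundamentalChain (K : AbstractSimplicialComplex V)
    (w : V → Fin (n + 1) → ℝ) : Finset V →₀ ℚ :=
  Finsupp.equivFunOnFinite.symm (facetSign K w)

theorem fundamentalChain_mem_cycles (h : IsCompleteSimplicialFan K w) (hn : 1 ≤ n) :
    fundamentalChain K w ∈ cycles K n := by
  have hc : fundamentalChain K w ∈ chains K n := by
    rw [chains, Finsupp.mem_supported]
    intro s hs
    by_contra hcon
    exact Finsupp.mem_support_iff.1 hs (dif_neg hcon)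
  refine ⟨hc, Finsupp.ext fun τ => ?_⟩
  by_cases hτ : ∃ a ∉ τ, insert a τ ∈ K.faces ∧ (insert a τ).card = n + 1
  · obtain ⟨a, ha, haτ, hcard⟩ := hτ
    rw [Finset.card_insert_of_notMem ha, Nat.add_right_cancel_iff] at hcard
    obtain ⟨b, -, ε, -, ⟨hb, hbτ⟩, hbd⟩ := h.exists_boundary_apply_eq hn hcard ha haτ
    rw [hbd _ hc]
    change (facetSign K w _ * _ - facetSign K w _ * _) * ε = 0
    rw [h.facetSign_mul_self haτ (by rw [Finset.card_insert_of_notMem ha, hcard]),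
      h.facetSign_mul_self hbτ (by rw [Finset.card_insert_of_notMem hb, hcard]), sub_self,
      zero_mul]
  · rw [boundary_apply hn hc]
    refine Finset.sum_eq_zero fun v hv => ?_
    rw [eq_zero_of_mem_chains hc, zero_mul]
    exact fun hvτ => hτ ⟨v, by simpa using hv, hvτ⟩

/-- The coefficients of a cycle agree on facets with a common ridge, after correction by the
orientations. -/
theorem cycle_eq_of_adjacent (h : IsCompleteSimplicialFan K w) (hn : 1 ≤ n)
    {c : Finset V →₀ ℚ} (hc : c ∈ cycles K n) {s t : Finset V} (hs : s ∈ K.faces)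
    (hsc : s.card = n + 1) (ht : t ∈ K.faces) (htc : t.card = n + 1) (hst : n ≤ (s ∩ t).card) :
    c s * facetSign K w s = c t * facetSign K w t := by
  by_cases hne : s = t
  · rw [hne]
  have hcard : (s ∩ t).card = n := by
    refine le_antisymm (Nat.lt_succ_iff.1 ?_) hst
    have hlt : (s ∩ t).card < s.card := Finset.card_lt_card
      (Finset.inter_subset_left.ssubset_of_ne fun he => hne
        (Finset.eq_of_subset_of_card_le (Finset.inter_eq_left.1 he) (by omega)))
    omega
  have hins : ∀ u : Finset V, u.card = n + 1 → s ∩ t ⊆ u → ∃ a ∉ s ∩ t, insert a (s ∩ t) = u :=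
    fun u hu hsub => Finset.covBy_iff_exists_insert.1 (Finset.covBy_iff_card_sdiff_eq_one.2
      ⟨hsub, by rw [Finset.card_sdiff_of_subset hsub]; omega⟩)
  obtain ⟨a, ha, has⟩ := hins s hsc Finset.inter_subset_left
  obtain ⟨a', ha', hat⟩ := hins t htc Finset.inter_subset_right
  obtain ⟨b, honly, ε, hε, -, hbd⟩ := h.exists_boundary_apply_eq hn hcard ha (by rwa [has])
  have hb : a' = b := (honly a' ha' (by rwa [hat])).resolve_left fun haa =>
    hne (has.symm.trans (haa ▸ hat))
  have h0 : boundary c (s ∩ t) = 0 := by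
    rw [LinearMap.mem_ker.1 hc.2]; rfl
  rw [hbd c hc.1, ← hb, has, hat] at h0
  exact sub_eq_zero.1 ((mul_eq_zero.1 h0).resolve_right hε)

/-- Any two facets are joined by a line that avoids the cones of codimension at least two, so the
coefficients of a cycle agree on all facets, after correction by the orientations. -/
theorem cycle_eq (h : IsCompleteSimplicialFan K w) (hn : 1 ≤ n)
    {c : Finset V →₀ ℚ} (hc : c ∈ cycles K n) {s t : Finset V} (hs : s ∈ K.faces)
    (hsc : s.card = n + 1) (ht : t ∈ K.faces) (htc : t.card = n + 1) :
    c s * facetSign K w s = c t * facetSign K w t := by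
  set p₀ : V → ℝ := fun v => if v ∈ s then 1 else 0 with hp₀
  have hp₀K : p₀ ∈ conicalRealization K :=
    ⟨fun v => by simp only [hp₀]; split_ifs <;> simp, s, hs, fun v hv => if_neg hv⟩
  set x := Fintype.linearCombination ℝ w p₀ with hx
  obtain ⟨y, hyt, hy⟩ := h.exists_mem_faceCone_notMem ht htc
    (fun τ : {τ : Finset V // τ.card < n} => Submodule.span ℝ (insert x (w '' τ.1))) fun τ => by
      have := span_ne_top_of_card_le (t := insert x (τ.1.image w))
        ((Finset.card_insert_le _ _).trans
          (Nat.succ_le_of_lt (Finset.card_image_le.trans_lt τ.2)))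
      rwa [Finset.coe_insert, Finset.coe_image] at this
  let γ : ℝ → Fin (n + 1) → ℝ := fun r => x + r • (y - x)
  have hγ : Continuous γ := by fun_prop
  by_contra hne
  -- The line through an interior point `x` of `s` and a point `y` of `t` is covered by the closed
  -- sets of points in facets with the same corrected coefficient as `s` and with another one; these
  -- two sets are disjoint because the line meets cones of codimension at most one only.
  let A (P : ℚ → Prop) : Set ℝ := ⋃ u ∈ {u | (u ∈ K.faces ∧ u.card = n + 1) ∧
    P (c u * facetSign K w u)}, γ ⁻¹' faceCone w u
  have hA : ∀ P, IsClosed (A P) := fun P => (Set.toFinite _).isClosed_biUnion fun u hu =>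
    (h.isClosed_faceCone hu.1.1).preimage hγ
  obtain ⟨r, -, hr1, hr2⟩ := isPreconnected_closed_iff.1 isPreconnected_univ
    (A (· = c s * facetSign K w s)) (A (· ≠ c s * facetSign K w s))
    (hA (· = c s * facetSign K w s)) (hA (· ≠ c s * facetSign K w s))
    (fun r _ => by
      obtain ⟨u, hu, huc, hru⟩ := h.exists_facet (γ r)
      by_cases hcu : c u * facetSign K w u = c s * facetSign K w s
      · exact Or.inl (Set.mem_biUnion (x := u) ⟨⟨hu, huc⟩, hcu⟩ hru)
      · exact Or.inr (Set.mem_biUnion (x := u) ⟨⟨hu, huc⟩, hcu⟩ hru))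
    ⟨0, trivial, Set.mem_biUnion (x := s) ⟨⟨hs, hsc⟩, rfl⟩
      ⟨p₀, hp₀K.1, fun v hv => if_neg hv, by simp [γ, hx]⟩⟩
    ⟨1, trivial, Set.mem_biUnion (x := t) ⟨⟨ht, htc⟩, fun he => hne he.symm⟩
      (by simpa [γ] using hyt)⟩
  obtain ⟨u₁, ⟨⟨hu₁, hu₁c⟩, he₁⟩, p, hp, hp₁, hpr⟩ := Set.mem_iUnion₂.1 hr1
  obtain ⟨u₂, ⟨⟨hu₂, hu₂c⟩, he₂⟩, q, hq, hq₂, hqr⟩ := Set.mem_iUnion₂.1 hr2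
  have hpq : p = q := h.injOn ⟨hp, _, hu₁, hp₁⟩ ⟨hq, _, hu₂, hq₂⟩ (hpr.trans hqr.symm)
  have hsupp : ∀ v ∉ u₁ ∩ u₂, p v = 0 := fun v hv => by
    by_cases hv₁ : v ∈ u₁
    · rw [hpq]; exact hq₂ v fun hv₂ => hv (Finset.mem_inter.2 ⟨hv₁, hv₂⟩)
    · exact hp₁ v hv₁
  refine he₂ ((h.cycle_eq_of_adjacent hn hc hu₂ hu₂c hu₁ hu₁c ?_).trans he₁)
  rw [Finset.inter_comm]
  by_contra hlt
  rw [not_le] at hlt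
  by_cases hr0 : r = 0
  · have hpp : p = p₀ := h.injOn ⟨hp, _, hu₁, hp₁⟩ hp₀K (by rw [hpr, hr0]; simp [γ, hx])
    have hsub : s ⊆ u₁ ∩ u₂ := fun v hv => by_contra fun hvn => by
      have := hsupp v hvn
      simp [hpp, hp₀, hv] at this
    have := Finset.card_le_card hsub
    omega
  · apply hy ⟨u₁ ∩ u₂, hlt⟩
    have h1 : γ r ∈ Submodule.span ℝ (insert x (w '' (u₁ ∩ u₂ : Finset V))) :=
      Submodule.span_mono (Set.subset_insert _ _) (hpr ▸ linearCombination_mem_span hsupp)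
    have h2 : x ∈ Submodule.span ℝ (insert x (w '' (u₁ ∩ u₂ : Finset V))) :=
      Submodule.subset_span (Set.mem_insert _ _)
    have h3 : y = x + r⁻¹ • (γ r - x) := by
      simp only [γ, add_sub_cancel_left, inv_smul_smul₀ hr0, add_sub_cancel]
    rw [h3]
    exact Submodule.add_mem _ h2 (Submodule.smul_mem _ _ (Submodule.sub_mem _ h1 h2))

theorem cycles_eq_span (h : IsCompleteSimplicialFan K w) (hn : 1 ≤ n) :
    cycles K n = Submodule.span ℚ {fundamentalChain K w} := by
  refine le_antisymm (fun c hc => ?_) ?_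
  · obtain ⟨t, ht, htc, -⟩ := h.exists_facet 0
    refine Submodule.mem_span_singleton.2 ⟨c t * facetSign K w t, Finsupp.ext fun s => ?_⟩
    change c t * facetSign K w t * facetSign K w s = c s
    by_cases hs : s ∈ K.faces ∧ s.card = n + 1
    · rw [← h.cycle_eq hn hc hs.1 hs.2 ht htc, mul_assoc, h.facetSign_mul_self hs.1 hs.2, mul_one]
    · rw [eq_zero_of_mem_chains hc.1 hs, show facetSign K w s = 0 from dif_neg hs, mul_zero]
  · rw [Submodule.span_singleton_le_iff_mem]
    exact h.fundamentalChain_mem_cycles hn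

theorem nonempty_homology_equiv (h : IsCompleteSimplicialFan K w) (hn : 1 ≤ n) :
    Nonempty (homology K n ≃ₗ[ℚ] ℚ) := by
  have hbd : boundaries K n = ⊥ := by
    have : chains K (n + 1) = ⊥ := by
      refine (Submodule.eq_bot_iff _).2 fun c hc => Finsupp.ext fun s => ?_
      exact eq_zero_of_mem_chains hc fun hs => by
        have := h.card_le hs.1
        omega
    rw [boundaries, this, Submodule.map_bot]
  have hz : fundamentalChain K w ≠ 0 := by
    intro h0
    obtain ⟨t, ht, htc, -⟩ := h.exists_facet 0
    have h1 := h.facetSign_mul_self ht htc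
    have h2 : facetSign K w t = 0 := DFunLike.congr_fun h0 t
    rw [h2, zero_mul] at h1
    exact zero_ne_one h1
  refine ⟨(Submodule.quotEquivOfEqBot _ ?_).trans
    ((LinearEquiv.ofEq _ _ (h.cycles_eq_span hn)).trans
      (LinearEquiv.toSpanNonzeroSingleton ℚ _ _ hz).symm)⟩
  rw [hbd, Submodule.submoduleOf, Submodule.comap_bot, Submodule.ker_subtype]

end IsCompleteSimplicialFan

/-! ### The Clemens complex of the degenerate fibre -/

theorem mainTheorem8 (n : ℕ) (hn : 1 ≤ n) (Φ : ToricFan (n + 1))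
    (hsmooth : Φ.IsSmooth) (hcomplete : Φ.IsComplete)
    (F : MvPolynomial Φ.rays ℂ) (hF : Φ.IsAnticanonicalSection F) :
    -- `n` is the top degree, and `H_n(Π(X₀), ℚ) ≅ ℚ`, for any ordering of the vertices
    (∀ s ∈ (clemensComplex (Φ.fiber F 0)).faces, s.card ≤ n + 1) ∧
    (∀ _ : LinearOrder (irreducibleComponents (Φ.fiber F 0)),
      Nonempty (SimplicialHomology.homology (clemensComplex (Φ.fiber F 0)) n ≃ₗ[ℚ] ℚ)) ∧
    -- the components of `X₀` are the `D_ρ`, and `Π(X₀)` is a triangulation of `∂Δ`: the point with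
    -- barycentric coordinates `p` is sent to the point of `∂Δ` on the ray through `∑ p_ρ ρ`
    (∃ e : Φ.rays ≃ irreducibleComponents (Φ.fiber F 0),
      (∀ ρ, Subtype.val '' (e ρ : Set (Φ.fiber F 0)) = Φ.divisor ρ) ∧
      ∃ h : geometricRealization (clemensComplex (Φ.fiber F 0)) ≃ₜ frontier Φ.polytope,
        ∀ p, ∃ c : ℝ, 0 < c ∧
          (h p : Fin (n + 1) → ℝ) = c • ∑ ρ : Φ.rays, p.1 (e ρ) • latticeToReal ρ.1) ∧
    -- which is a topological `n`-sphere
    Nonempty (geometricRealization (clemensComplex (Φ.fiber F 0)) ≃ₜ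
      Metric.sphere (0 : EuclideanSpace ℝ (Fin (n + 1))) 1) := by
  obtain ⟨e, he⟩ := Φ.exists_equiv_components_fiber_zero F
  let _ : Fintype (irreducibleComponents (Φ.fiber F 0)) := Fintype.ofEquiv _ e
  have hfan := ToricFan.isCompleteSimplicialFan n.succ_pos Φ hsmooth hcomplete e.symm
    (clemensComplex (Φ.fiber F 0)) (Φ.mem_faces_clemensComplex_iff F he)
  refine ⟨fun s hs => hfan.card_le hs, fun _ => hfan.nonempty_homology_equiv hn,
    ⟨e, fun ρ => ?_, ?_⟩, hfan.nonempty_homeomorph_sphere⟩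
  · rw [he, Subtype.image_preimage_coe, Set.inter_eq_right, Φ.fiber_zero]
    exact Set.subset_iUnion _ ρ
  · have hΔ : Φ.polytope = convexHull ℝ (Set.range fun C => latticeToReal (e.symm C).1) := by
      rw [ToricFan.polytope, Set.range_comp' (fun ρ : Φ.rays => latticeToReal ρ.1) e.symm,
        e.symm.range_eq_univ, Set.image_univ, Set.image_eq_range]
    rw [hΔ]
    obtain ⟨φ, hφ⟩ := hfan.exists_homeomorph_frontier (convex_convexHull ℝ _)
      hfan.convexHull_range_mem_nhds_zero
      (NormedSpace.isVonNBounded_of_isBounded ℝ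
        (isBounded_convexHull.2 (Set.finite_range _).isBounded))
    refine ⟨φ, fun p => ?_⟩
    obtain ⟨c, hc, hcp⟩ := hφ p
    refine ⟨c, hc, hcp.trans ?_⟩
    rw [Fintype.linearCombination_apply, ← e.sum_comp]
    simp only [e.symm_apply_apply]
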